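/- Consider the one-dimensional thin-film free boundary problem $$u_t+(u\,u_{xxx})_x=0\quad (t>0,\ \lambda_-(t)<x<\lambda_+(t)),\qquad u(t,\lambda_\pm(t))=0,\quad |u_x(t,\lambda_\pm(t))|=1,\quad \lim_{x\to\lambda_\pm(t)}u_{xxx}(t,x)=\dot\lambda_\pm(t),$$ with $u(t,\cdot)>0$ on $(\lambda_-(t),\lambda_+(t))$. A global smooth solution is a solution $(u,\lambda_-,\lambda_+)$ on $[0,\infty)$ such that $\lambda_\pm$ are real-valued, smooth for $t>0$ and continuous for $t\ge 0$, with $\lambda_-<\lambda_+$; $u$ is $C^\infty$ up to the moving boundary for $t>0$; $u,u_x,u_{xx}$ are continuous on $\{t\ge 0,\ \lambda_-(t)\le x\le\lambda_+(t)\}$; and the positivity, the vanishing of $u$ and the contact angle condition at $\lambda_\pm$ hold also at $t=0$. Let $u^\infty(y)=\tfrac12(1-y^2)_+$. For a solution of mass $2/3$ define the mass Lagrangian variable $Z(t,\cdot):[-1,1]\to[\lambda_-(t),\lambda_+(t)]$ by $$\int_{\lambda_-(t)}^{Z(t,y)}u(t,x)\,dx=\frac12\int_{-1}^{y}(1-s^2)\,ds,$$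 let $Z^\infty(y)=y$, and define the energy $$E(t)=\frac12\int_{-1}^{1}\Big|\partial_y\Big(\frac{u(t,Z(t,y))}{u^\infty(y)}\Big)\Big|^2dy .$$ There exist constants $c_0>0$, $\gamma>0$, $C>0$ and $T\ge 0$ such that every global smooth solution with initial data $u_0=u(0,\cdot)$ satisfying $\int_{\lambda_-(0)}^{\lambda_+(0)}u_0\,dx=\tfrac23$, $\int_{\lambda_-(0)}^{\lambda_+(0)}x\,u_0\,dx=0$ and $E(0)<c_0$ satisfies $$E(t)\le E(0)\,e^{-\gamma t}\qquad\text{for all } t\ge 0,$$ and, for all $t\ge T$, $Z(t,\cdot)$ is differentiable on $(-1,1)$ and $$\big\|\partial_y\big(Z(t,\cdot)-Z^\infty\big)\big\|_{L^\infty(-1,1)}\le C\,e^{-\frac{\gamma}{2}t}.$$ -/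

import Mathlib

open MeasureTheory Set Filter Topology
open scoped ENNReal ContDiff

noncomputable section

namespace ThinFilm

/-- The closed wetted region up to (and including) the initial time:
the set of all `(t, x)` with `t ≥ 0` and `lm t ≤ x ≤ lp t`. -/
def closedRegion (lm lp : ℝ → ℝ) : Set (ℝ × ℝ) :=
  {p | 0 ≤ p.1 ∧ p.2 ∈ Icc (lm p.1) (lp p.1)}

/-- `u` is smooth up to the moving boundary for positive times: on the set of `(t, x)` with
`t > 0` and `lm t ≤ x ≤ lp t` it coincides with a `C^∞` function of `(t, x) ∈ (0, ∞) × ℝ`. -/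
def SmoothUpToBoundary (u : ℝ → ℝ → ℝ) (lm lp : ℝ → ℝ) : Prop :=
  ∃ U : ℝ × ℝ → ℝ, ContDiffOn ℝ ∞ U (Ioi 0 ×ˢ univ) ∧
    ∀ t : ℝ, 0 < t → ∀ x ∈ Icc (lm t) (lp t), u t x = U (t, x)

/-- `u`, `u_x` and `u_xx` (one-sided at the end points of the support) are continuous on the closed
wetted region, the initial time included. -/
def C2UpToInitialTime (u : ℝ → ℝ → ℝ) (lm lp : ℝ → ℝ) : Prop :=
  ContDiffOn ℝ 2 (u 0) (Icc (lm 0) (lp 0)) ∧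
    ∀ k : ℕ, k ≤ 2 →
      ContinuousOn (fun p : ℝ × ℝ => iteratedDerivWithin k (u p.1) (Icc (lm p.1) (lp p.1)) p.2)
        (closedRegion lm lp)

/-- Global smooth solution of the thin-film free boundary problem with linear mobility and
contact angle one. The film at time `t ≥ 0` occupies `(lm t, lp t)`; the height is `u t x` and
the initial height is `u 0`. Only the values of `u t` on `[lm t, lp t]` matter. -/
structure IsGlobalSmoothSolution (u : ℝ → ℝ → ℝ) (lm lp : ℝ → ℝ) : Prop where
  lt : ∀ t : ℝ, 0 ≤ t → lm t < lp t
  lm_continuous : ContinuousOn lm (Ici 0)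
  lp_continuous : ContinuousOn lp (Ici 0)
  lm_smooth : ContDiffOn ℝ ∞ lm (Ioi 0)
  lp_smooth : ContDiffOn ℝ ∞ lp (Ioi 0)
  smooth : SmoothUpToBoundary u lm lp
  initial : C2UpToInitialTime u lm lp
  /-- positivity inside the support -/
  pos : ∀ t : ℝ, 0 ≤ t → ∀ x ∈ Ioo (lm t) (lp t), 0 < u t x
  /-- `u_t + (u u_xxx)_x = 0` -/
  equation : ∀ t : ℝ, 0 < t → ∀ x ∈ Ioo (lm t) (lp t),
    deriv (fun s => u s x) t + deriv (fun z => u t z * iteratedDeriv 3 (u t) z) x = 0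
  /-- the height vanishes at the two contact points -/
  left_zero : ∀ t : ℝ, 0 ≤ t → u t (lm t) = 0
  right_zero : ∀ t : ℝ, 0 ≤ t → u t (lp t) = 0
  /-- contact angle condition `|u_x| = 1` (one-sided derivatives) -/
  left_angle : ∀ t : ℝ, 0 ≤ t → |derivWithin (u t) (Icc (lm t) (lp t)) (lm t)| = 1
  right_angle : ∀ t : ℝ, 0 ≤ t → |derivWithin (u t) (Icc (lm t) (lp t)) (lp t)| = 1
  /-- kinematic condition: `u_xxx` tends to the velocity of the contact point -/
  left_velocity : ∀ t : ℝ, 0 < t →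
    Tendsto (iteratedDeriv 3 (u t)) (𝓝[>] (lm t)) (𝓝 (deriv lm t))
  right_velocity : ∀ t : ℝ, 0 < t →
    Tendsto (iteratedDeriv 3 (u t)) (𝓝[<] (lp t)) (𝓝 (deriv lp t))

/-- The stationary profile `u^∞(y) = (1 - y²)₊ / 2`. -/
def steadyState (y : ℝ) : ℝ := (1 / 2) * max (1 - y ^ 2) 0

/-- The mass Lagrangian variable: for `y ∈ [-1, 1]`, `lagrangianMap u lm lp t y` is the point
`x ∈ [lm t, lp t]` with `∫_{lm t}^x u(t, ·) = (1/2) ∫_{-1}^y (1 - s²) ds`. For a positive height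
of mass `2/3` there is exactly one such `x`, so that `sInf` merely picks the element of a
singleton. -/
def lagrangianMap (u : ℝ → ℝ → ℝ) (lm lp : ℝ → ℝ) (t y : ℝ) : ℝ :=
  sInf {x : ℝ | x ∈ Icc (lm t) (lp t) ∧
    ∫ z in (lm t)..x, u t z = (1 / 2) * ∫ s in (-1 : ℝ)..y, (1 - s ^ 2)}

/-- The Lagrangian map `Z^∞(y) = y` of the stationary profile. -/
def steadyLagrangianMap (y : ℝ) : ℝ := y

/-- The height in Lagrangian coordinates, `ũ(t, y) = u(t, Z(t, y))`. -/
def lagrangianHeight (u : ℝ → ℝ → ℝ) (lm lp : ℝ → ℝ) (t y : ℝ) : ℝ :=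
  u t (lagrangianMap u lm lp t y)

/-- The energy `E(t) = (1/2) ∫_{-1}^1 |∂_y (ũ(t, y) / u^∞(y))|² dy`, with values in `[0, ∞]`. -/
def energy (u : ℝ → ℝ → ℝ) (lm lp : ℝ → ℝ) (t : ℝ) : ℝ≥0∞ :=
  (1 / 2) * ∫⁻ y in Ioo (-1 : ℝ) 1,
    ‖deriv (fun z => lagrangianHeight u lm lp t z / steadyState z) y‖ₑ ^ 2

end ThinFilm

end

/-! In the mass Lagrangian variable the moving domain becomes the fixed interval [-1, 1]. Put w = (1
- y²)/2 and F = 1/Z_y, so that the height along the flow is wF and F is the ratio in the energy.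
Conservation of mass to the left of Z(t, y) says that Z moves with velocity N = u_xxx. Since ∂_x
becomes F∂_y, N is (F∂_y)³(wF), an explicit polynomial in y, F and its first three derivatives
(`velocityExpr`). Hence F_t = -F² ∂_y N, and the contact angle condition becomes the Dirichlet
condition F(±1) = 1, so F_t also vanishes at ±1.

The core is `energy_dissipation`. Differentiating (1/2)∫F_y² and integrating by parts leaves
boundary terms of favourable sign and, to leading order, -∫(w F_yyy² + 8 F_yy²). The remaining terms
are of higher order. They are absorbed because F - 1 is small, with a square-root decay at ±1 that
compensates the degenerate weight w, and because F_y has a zero by Rolle and is therefore controlled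
by F_yy. The same zero gives a Poincaré inequality, so while the Dirichlet integral is small the
dissipation dominates it. A comparison argument shows that smallness persists and yields exponential
decay (`dirichlet_decay`).

Two regularity questions must be settled. First, Z has to be smooth up to y = ±1 at positive times,
although the map from position to mass has vanishing derivative at the contact points. Both masses
there are quadratic in the distance, so after taking square roots the implicit function theorem
applies (`ContactData.contDiffOn`). Second, at t = 0 only two space derivatives are continuous, so
the energy identity is unavailable there. A bound on F_y, uniform for t in [0, 1], gives convergence
of the energy as t decreases to 0 (`tendsto_energy`), and the decay estimate is passed to this
limit.

Finally, F = 1 at the left end and Cauchy–Schwarz bound F - 1 uniformly by the square root of the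
energy, which gives the rate γ/2 for Z_y - 1. -/

noncomputable section

namespace ThinFilm

/-! ### One-dimensional interpolation inequalities -/

/-- Cauchy–Schwarz for interval integrals of continuous functions. -/
theorem sq_integral_mul_le {a b : ℝ} (hab : a ≤ b) {f g : ℝ → ℝ}
    (hf : ContinuousOn f (Icc a b)) (hg : ContinuousOn g (Icc a b)) :
    (∫ x in a..b, f x * g x) ^ 2 ≤ (∫ x in a..b, f x ^ 2) * ∫ x in a..b, g x ^ 2 := by
  rw [← uIcc_of_le hab] at hf hg
  have h1 : IntervalIntegrable (fun x => f x ^ 2) volume a b := (hf.pow 2).intervalIntegrable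
  have h2 : IntervalIntegrable (fun x => f x * g x) volume a b := (hf.mul hg).intervalIntegrable
  have h3 : IntervalIntegrable (fun x => g x ^ 2) volume a b := (hg.pow 2).intervalIntegrable
  have key : ∀ t : ℝ, 0 ≤ (∫ x in a..b, g x ^ 2) * (t * t) + (-2 * ∫ x in a..b, f x * g x) * t +
      ∫ x in a..b, f x ^ 2 := by
    intro t
    have : (∫ x in a..b, g x ^ 2) * (t * t) + (-2 * ∫ x in a..b, f x * g x) * t +
      ∫ x in a..b, f x ^ 2 = ∫ x in a..b, (f x - t * g x) ^ 2 := by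
      have e : (fun x => (f x - t * g x) ^ 2) =
          fun x => (t * t) * g x ^ 2 + (-2 * t) * (f x * g x) + f x ^ 2 := by
        funext x; ring
      rw [e, intervalIntegral.integral_add ((h3.const_mul _).add (h2.const_mul _)) h1,
        intervalIntegral.integral_add (h3.const_mul _) (h2.const_mul _),
        intervalIntegral.integral_const_mul, intervalIntegral.integral_const_mul]
      ring
    rw [this]
    exact intervalIntegral.integral_nonneg hab fun x _ => sq_nonneg _
  have := discrim_le_zero key
  rw [discrim] at this
  nlinarith

theorem sq_integral_le {a b : ℝ} (hab : a ≤ b) {f : ℝ → ℝ} (hf : ContinuousOn f (Icc a b)) :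
    (∫ x in a..b, f x) ^ 2 ≤ (b - a) * ∫ x in a..b, f x ^ 2 := by
  have := sq_integral_mul_le hab hf (continuousOn_const (c := (1 : ℝ)))
  simp only [mul_one, one_pow, intervalIntegral.integral_const, smul_eq_mul] at this
  linarith

theorem integral_sq_mono {a b c d : ℝ} (hac : a ≤ c) (hcd : c ≤ d) (hdb : d ≤ b) {f : ℝ → ℝ}
    (hf : ContinuousOn f (Icc a b)) :
    ∫ x in c..d, f x ^ 2 ≤ ∫ x in a..b, f x ^ 2 := by
  apply intervalIntegral.integral_mono_interval hac hcd hdb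
  · exact Eventually.of_forall fun x => sq_nonneg _
  · apply ContinuousOn.intervalIntegrable
    rw [uIcc_of_le (by linarith)]
    exact hf.pow 2

/-- The squared increment of a `C¹` function is controlled by the length times the energy. -/
theorem sq_sub_le {a b : ℝ} {f f' : ℝ → ℝ} (hf : ContinuousOn f (Icc a b))
    (hd : ∀ y ∈ Ioo a b, HasDerivAt f (f' y) y) (hf' : ContinuousOn f' (Icc a b))
    {x y : ℝ} (hx : x ∈ Icc a b) (hy : y ∈ Icc a b) :
    (f y - f x) ^ 2 ≤ |y - x| * ∫ s in a..b, f' s ^ 2 := by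
  wlog hxy : x ≤ y generalizing x y
  · have := this hy hx (by linarith)
    rw [abs_sub_comm]; nlinarith
  have hsub : Icc x y ⊆ Icc a b := Icc_subset_Icc hx.1 hy.2
  have hint : ∫ s in x..y, f' s = f y - f x := by
    apply intervalIntegral.integral_eq_sub_of_hasDerivAt_of_le hxy (hf.mono hsub)
    · intro s hs; exact hd s ⟨lt_of_le_of_lt hx.1 hs.1, lt_of_lt_of_le hs.2 hy.2⟩
    · apply ContinuousOn.intervalIntegrable
      rw [uIcc_of_le hxy]; exact hf'.mono hsub
  rw [← hint, abs_of_nonneg (by linarith)]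
  refine (sq_integral_le hxy (hf'.mono hsub)).trans ?_
  exact mul_le_mul_of_nonneg_left (integral_sq_mono hx.1 hxy hy.2 hf') (by linarith)

/-- If `f` vanishes somewhere on `[a, b]`, then `f²` is controlled by `‖f‖ ‖f'‖`. -/
theorem pow_four_le_of_zero {a b : ℝ} {f f' : ℝ → ℝ} (hf : ContinuousOn f (Icc a b))
    (hd : ∀ y ∈ Ioo a b, HasDerivAt f (f' y) y) (hf' : ContinuousOn f' (Icc a b))
    {x y : ℝ} (hx : x ∈ Icc a b) (hy : y ∈ Icc a b) (h0 : f x = 0) :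
    f y ^ 4 ≤ 4 * (∫ s in a..b, f s ^ 2) * ∫ s in a..b, f' s ^ 2 := by
  have key : ∀ c d, a ≤ c → c ≤ d → d ≤ b → (f d ^ 2 - f c ^ 2) ^ 2 ≤
      4 * (∫ s in a..b, f s ^ 2) * ∫ s in a..b, f' s ^ 2 := by
    intro c d hac hcd hdb
    have hsub : Icc c d ⊆ Icc a b := Icc_subset_Icc hac hdb
    have hint : ∫ s in c..d, 2 * (f s * f' s) = f d ^ 2 - f c ^ 2 := by
      apply intervalIntegral.integral_eq_sub_of_hasDerivAt_of_le hcd ((hf.mono hsub).pow 2)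
      · intro s hs
        have := (hd s ⟨lt_of_le_of_lt hac hs.1, lt_of_lt_of_le hs.2 hdb⟩).pow 2
        exact this.congr_deriv (by push_cast; ring)
      · apply ContinuousOn.intervalIntegrable
        rw [uIcc_of_le hcd]; exact continuousOn_const.mul ((hf.mul hf').mono hsub)
    rw [← hint, intervalIntegral.integral_const_mul]
    have h1 := sq_integral_mul_le hcd (hf.mono hsub) (hf'.mono hsub)
    have h2 := integral_sq_mono hac hcd hdb hf
    have h3 := integral_sq_mono hac hcd hdb hf'
    have h4 : 0 ≤ ∫ s in c..d, f' s ^ 2 :=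
      intervalIntegral.integral_nonneg hcd fun _ _ => sq_nonneg _
    have h5 : 0 ≤ ∫ s in a..b, f s ^ 2 :=
      intervalIntegral.integral_nonneg (by linarith) fun _ _ => sq_nonneg _
    have h6 := mul_le_mul h2 h3 h4 h5
    nlinarith
  rcases le_total x y with h | h
  · have := key x y hx.1 h hy.2
    rw [h0] at this; nlinarith
  · have := key y x hy.1 h hx.2
    rw [h0] at this; nlinarith

/-! ### Dissipation of the Dirichlet energy -/

set_option maxHeartbeats 2000000 in
/-- The pointwise estimate for the terms of the dissipation identity. -/
theorem dissipation_integrand_le {F p h k y D : ℝ} (hy : y ^ 2 ≤ 1)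
    (hF : (F - 1) ^ 2 ≤ (1 / 1000) ^ 2 * (1 - y ^ 2)) (hD : 0 ≤ D)
    (hp : p ^ 2 ≤ 2 * D) (hp4 : p ^ 4 ≤ 4 * (1 / 1000) ^ 2 * D)
    (hh : (1 - y ^ 2) / 2 * h ^ 2 ≤ 2 * D) :
    -((1 - y ^ 2) / 2) * F ^ 5 * k ^ 2 - 8 * F ^ 5 * h ^ 2
      + 16 / 5 * (F ^ 5 - 1) * (h ^ 2 + 2 * y * h * k) - 25 * F ^ 4 * p ^ 2 * h
      - 6 * ((1 - y ^ 2) / 2) * F ^ 4 * p * h * k - (1 - y ^ 2) / 2 * F ^ 3 * p ^ 3 * k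
      - 14 * y * F ^ 3 * p ^ 3 * h - 8 * ((1 - y ^ 2) / 2) * F ^ 3 * p ^ 2 * h ^ 2
      - 2 * ((1 - y ^ 2) / 2) * F ^ 2 * p ^ 4 * h
    ≤ -(1 / 2) * ((1 - y ^ 2) / 2 * k ^ 2 + h ^ 2) + 100000 * D * p ^ 2 := by
  obtain ⟨w, hw⟩ : ∃ w, w = (1 - y ^ 2) / 2 := ⟨_, rfl⟩
  have hy2 : 1 - y ^ 2 = 2 * w := by rw [hw]; ring
  rw [hy2] at hF
  rw [← hw] at hh ⊢
  have hw0 : 0 ≤ w := by rw [hw]; linarith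
  have hw1 : w ≤ 1 / 2 := by rw [hw]; nlinarith [sq_nonneg y]
  have hFa : |F - 1| ≤ 1 / 1000 := by
    apply abs_le_of_sq_le_sq _ (by norm_num)
    nlinarith
  obtain ⟨hF1, hF2⟩ := abs_le.mp hFa
  have hFl : (999 / 1000 : ℝ) ≤ F := by linarith
  have hFu : F ≤ 1001 / 1000 := by linarith
  have hF0 : (0 : ℝ) ≤ F := by linarith
  have u2 : F ^ 2 ≤ 11 / 10 := (pow_le_pow_left₀ hF0 hFu 2).trans (by norm_num)
  have u3 : F ^ 3 ≤ 11 / 10 := (pow_le_pow_left₀ hF0 hFu 3).trans (by norm_num)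
  have u4 : F ^ 4 ≤ 11 / 10 := (pow_le_pow_left₀ hF0 hFu 4).trans (by norm_num)
  have l5 : 9 / 10 ≤ F ^ 5 := le_trans (by norm_num) (pow_le_pow_left₀ (by norm_num) hFl 5)
  have p2 : 0 ≤ F ^ 2 := by positivity
  have p3 : 0 ≤ F ^ 3 := by positivity
  have p4 : 0 ≤ F ^ 4 := by positivity
  have hk0 : 0 ≤ w * k ^ 2 := by positivity
  have hh0 : 0 ≤ h ^ 2 := by positivity
  have hDp : 0 ≤ D * p ^ 2 := by positivity
  -- With p = F_y, every p⁴, p⁶ or w h² p² is reduced to a multiple of D p². After integration this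
  -- is D times the Dirichlet integral, hence a small fraction of D.
  have p6 : p ^ 6 ≤ 4 * (1 / 1000) ^ 2 * (D * p ^ 2) := by
    have := mul_le_mul_of_nonneg_right hp4 (sq_nonneg p); linarith
  have p4' : p ^ 4 ≤ 2 * (D * p ^ 2) := by
    have := mul_le_mul_of_nonneg_right hp (sq_nonneg p); linarith
  have hwh : w * h ^ 2 * p ^ 2 ≤ 2 * (D * p ^ 2) := by
    have := mul_le_mul_of_nonneg_right hh (sq_nonneg p); linarith
  have absF : ∀ (c a : ℝ), 0 ≤ c → c ≤ 11 / 10 → c * a ≤ 11 / 10 * |a| := by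
    intro c a h0 h1
    calc c * a ≤ c * |a| := mul_le_mul_of_nonneg_left (le_abs_self a) h0
      _ ≤ _ := mul_le_mul_of_nonneg_right h1 (abs_nonneg a)
  have young : ∀ (a b η : ℝ), 0 < η → |a * b| ≤ (η * a ^ 2 + b ^ 2 / η) / 2 := by
    intro a b η hη
    have e : (η * a ^ 2 + b ^ 2 / η) / 2 - |a * b| = (η * |a| - |b|) ^ 2 / (2 * η) := by
      rw [abs_mul]
      field_simp
      nlinarith [sq_abs a, sq_abs b]
    have : 0 ≤ (η * |a| - |b|) ^ 2 / (2 * η) := by positivity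
    linarith
  have T0 : -w * F ^ 5 * k ^ 2 - 8 * F ^ 5 * h ^ 2 ≤ -(9 / 10) * (w * k ^ 2) - 7 * h ^ 2 := by
    have a := mul_le_mul_of_nonneg_right l5 hk0
    have b := mul_le_mul_of_nonneg_right l5 hh0
    linarith
  -- The product h k carries no weight, whereas only w k² is available. The missing factor comes
  -- from (F - 1)² ≤ 2 · 10⁻⁶ w, which is why the bound on F - 1 must decay at ±1.
  have T1 : 16 / 5 * (F ^ 5 - 1) * (h ^ 2 + 2 * y * h * k) ≤ 1 / 10 * (w * k ^ 2) + h ^ 2 := by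
    have e : F ^ 5 - 1 = (F - 1) * (F ^ 4 + F ^ 3 + F ^ 2 + F + 1) := by ring
    have c0 : 0 ≤ F ^ 4 + F ^ 3 + F ^ 2 + F + 1 := by positivity
    have c1 : F ^ 4 + F ^ 3 + F ^ 2 + F + 1 ≤ 11 / 2 := by linarith
    have a1 : (F - 1) * (h ^ 2 + 2 * y * h * k) ≤ 2 / 1000 * (h ^ 2 + w * k ^ 2) := by
      have b1 : (F - 1) * h ^ 2 ≤ 1 / 1000 * h ^ 2 :=
        mul_le_mul_of_nonneg_right hF2 hh0
      have b2 := young (y * h) ((F - 1) * k) (1 / 1000) (by norm_num)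
      have b3 : (y * h) ^ 2 ≤ h ^ 2 := by
        have := mul_le_mul_of_nonneg_right hy hh0
        linarith
      have b4 : ((F - 1) * k) ^ 2 ≤ (1 / 1000) ^ 2 * 2 * (w * k ^ 2) := by
        have := mul_le_mul_of_nonneg_right hF (sq_nonneg k); linarith
      have b5 := le_abs_self (y * h * ((F - 1) * k))
      have b6 : ((F - 1) * k) ^ 2 / (1 / 1000) = 1000 * ((F - 1) * k) ^ 2 := by ring
      rw [b6] at b2
      linarith
    have a2 : 0 ≤ 2 / 1000 * (h ^ 2 + w * k ^ 2) := by positivity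
    rw [e]
    calc 16 / 5 * ((F - 1) * (F ^ 4 + F ^ 3 + F ^ 2 + F + 1)) * (h ^ 2 + 2 * y * h * k)
        = 16 / 5 * ((F ^ 4 + F ^ 3 + F ^ 2 + F + 1) * ((F - 1) * (h ^ 2 + 2 * y * h * k))) := by
          ring
      _ ≤ 16 / 5 * ((11 / 2) * (2 / 1000 * (h ^ 2 + w * k ^ 2))) := by
          exact mul_le_mul_of_nonneg_left ((mul_le_mul_of_nonneg_left a1 c0).trans
            (mul_le_mul_of_nonneg_right c1 a2)) (by norm_num)
      _ ≤ _ := by linarith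
  -- The remaining terms use Young's inequality with a small constant on h² or w k², which leaves
  -- multiples of D p²; the term `T6` has a sign, and `T7` is bounded by D p² alone.
  have T2 : -25 * F ^ 4 * p ^ 2 * h ≤ 1 / 10 * h ^ 2 + 50000 * (D * p ^ 2) := by
    have a := absF (F ^ 4) (-(h * p ^ 2)) p4 u4
    rw [abs_neg] at a
    have b := young h (p ^ 2) (1 / 1000) (by norm_num)
    have b6 : (p ^ 2) ^ 2 / (1 / 1000 : ℝ) = 1000 * p ^ 4 := by ring
    rw [b6] at b
    linarith
  have T3 : -6 * w * F ^ 4 * p * h * k ≤ 1 / 10 * (w * k ^ 2) + 10000 * (D * p ^ 2) := by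
    have a := absF (F ^ 4) (-(k * (p * h))) p4 u4
    rw [abs_neg] at a
    have b := young k (p * h) (1 / 1000) (by norm_num)
    have b6 : (p * h) ^ 2 / (1 / 1000 : ℝ) = 1000 * (h ^ 2 * p ^ 2) := by ring
    rw [b6] at b
    have c := mul_le_mul_of_nonneg_left (a.trans (mul_le_mul_of_nonneg_left b (by norm_num))) hw0
    linarith
  have T4 : -(w * F ^ 3 * p ^ 3 * k) ≤ 1 / 10 * (w * k ^ 2) + 100 * (D * p ^ 2) := by
    have a := absF (F ^ 3) (-(k * p ^ 3)) p3 u3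
    rw [abs_neg] at a
    have b := young k (p ^ 3) (1 / 1000) (by norm_num)
    have b6 : (p ^ 3) ^ 2 / (1 / 1000 : ℝ) = 1000 * p ^ 6 := by ring
    rw [b6] at b
    have c := mul_le_mul_of_nonneg_left (a.trans (mul_le_mul_of_nonneg_left b (by norm_num))) hw0
    have d : w * p ^ 6 ≤ p ^ 6 := by
      exact mul_le_of_le_one_left (by positivity) (by linarith)
    linarith
  have T5 : -14 * y * F ^ 3 * p ^ 3 * h ≤ 1 / 10 * h ^ 2 + 100 * (D * p ^ 2) := by
    have a := absF (F ^ 3) (-(y * h * p ^ 3)) p3 u3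
    rw [abs_neg] at a
    have b := young (y * h) (p ^ 3) (1 / 1000) (by norm_num)
    have b6 : (p ^ 3) ^ 2 / (1 / 1000 : ℝ) = 1000 * p ^ 6 := by ring
    rw [b6] at b
    have b3 : (y * h) ^ 2 ≤ h ^ 2 := by
      have := mul_le_mul_of_nonneg_right hy hh0
      linarith
    linarith
  have T6 : -8 * w * F ^ 3 * p ^ 2 * h ^ 2 ≤ 0 := by
    have : 0 ≤ w * F ^ 3 * p ^ 2 * h ^ 2 := by positivity
    linarith
  have T7 : -2 * w * F ^ 2 * p ^ 4 * h ≤ 100 * (D * p ^ 2) := by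
    have a := absF (F ^ 2) (-(h * p ^ 2)) p2 u2
    rw [abs_neg] at a
    have b := young h (p ^ 2) 1 (by norm_num)
    rw [div_one, one_mul] at b
    have c := mul_le_mul_of_nonneg_left (a.trans (mul_le_mul_of_nonneg_left b (by norm_num)))
      (mul_nonneg hw0 (sq_nonneg p))
    have d : w * p ^ 6 ≤ p ^ 6 := by
      exact mul_le_of_le_one_left (by positivity) (by linarith)
    linarith
  -- The budget: w k² keeps -9/10 + 3/10, h² keeps -7 + 12/10, and the coefficients of D p² add up
  -- to less than 100000.
  linarith

/-- The velocity `u_xxx` of the Lagrangian flow, expressed by `F = 1 / Z_y` and its derivatives. -/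
def velocityExpr (y F p h k : ℝ) : ℝ :=
  (1 - y ^ 2) / 2 * F ^ 3 * k + 4 * ((1 - y ^ 2) / 2) * F ^ 2 * p * h
    + (1 - y ^ 2) / 2 * F * p ^ 3 - 4 * y * F ^ 3 * h - 7 * y * F ^ 2 * p ^ 2 - 6 * F ^ 3 * p

/-- Energy dissipation at a fixed time: if `F` is a smooth function with `F(±1) = 1`, with small
Dirichlet energy, whose time derivative is `-F² ∂_y N`, where `N` is the Lagrangian velocity, then
the time derivative of the energy is bounded by a negative multiple of the energy. -/
theorem energy_dissipation {f0 f1 f2 f3 n n1 ft ft1 : ℝ → ℝ}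
    (c0 : ContinuousOn f0 (Icc (-1) 1)) (c1 : ContinuousOn f1 (Icc (-1) 1))
    (c2 : ContinuousOn f2 (Icc (-1) 1)) (c3 : ContinuousOn f3 (Icc (-1) 1))
    (d0 : ∀ y ∈ Ioo (-1 : ℝ) 1, HasDerivAt f0 (f1 y) y)
    (d1 : ∀ y ∈ Ioo (-1 : ℝ) 1, HasDerivAt f1 (f2 y) y)
    (d2 : ∀ y ∈ Ioo (-1 : ℝ) 1, HasDerivAt f2 (f3 y) y)
    (hn : ∀ y ∈ Ioo (-1 : ℝ) 1, n y = velocityExpr y (f0 y) (f1 y) (f2 y) (f3 y))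
    (dn : ∀ y ∈ Ioo (-1 : ℝ) 1, HasDerivAt n (n1 y) y)
    (ct : ContinuousOn ft (Icc (-1) 1)) (ct1 : ContinuousOn ft1 (Icc (-1) 1))
    (dt : ∀ y ∈ Ioo (-1 : ℝ) 1, HasDerivAt ft (ft1 y) y)
    (ht : ∀ y ∈ Ioo (-1 : ℝ) 1, ft y = -(f0 y ^ 2 * n1 y))
    (htl : ft (-1) = 0) (htr : ft 1 = 0) (hl : f0 (-1) = 1) (hr : f0 1 = 1)
    (hsmall : ∫ y in (-1)..1, f1 y ^ 2 ≤ (1 / 1000) ^ 2) :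
    ∫ y in (-1)..1, f1 y * ft1 y ≤ -(1 / 16) * ∫ y in (-1)..1, f1 y ^ 2 := by
  have hle : (-1 : ℝ) ≤ 1 := by norm_num
  have hml : (-1 : ℝ) ∈ Icc (-1 : ℝ) 1 := ⟨le_rfl, hle⟩
  have hmr : (1 : ℝ) ∈ Icc (-1 : ℝ) 1 := ⟨hle, le_rfl⟩
  have II : ∀ {g : ℝ → ℝ}, ContinuousOn g (Icc (-1) 1) → IntervalIntegrable g volume (-1) 1 := by
    intro g hg
    apply ContinuousOn.intervalIntegrable
    rwa [uIcc_of_le hle]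
  have cw : ContinuousOn (fun y : ℝ => (1 - y ^ 2) / 2) (Icc (-1) 1) := by fun_prop
  set q := ∫ y in (-1)..1, f1 y ^ 2 with hq
  set D2 := ∫ y in (-1)..1, f2 y ^ 2 with hD2
  set D3 := ∫ y in (-1)..1, (1 - y ^ 2) / 2 * f3 y ^ 2 with hD3
  have hq0 : 0 ≤ q := intervalIntegral.integral_nonneg hle fun _ _ => sq_nonneg _
  have hD20 : 0 ≤ D2 := intervalIntegral.integral_nonneg hle fun _ _ => sq_nonneg _
  have hD30 : 0 ≤ D3 := intervalIntegral.integral_nonneg hle fun y hy => by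
    have : y ^ 2 ≤ 1 := by nlinarith [hy.1, hy.2]
    have := sq_nonneg (f3 y)
    apply mul_nonneg _ this; linarith
  have i22 : IntervalIntegrable (fun y => 2 * f2 y ^ 2) volume (-1) 1 := II (by fun_prop)
  have i33 : IntervalIntegrable (fun y => (1 - y ^ 2) / 2 * f3 y ^ 2) volume (-1) 1 :=
    II (by fun_prop)
  have hysq : ∀ y ∈ Icc (-1 : ℝ) 1, y ^ 2 ≤ 1 := fun y hy => by nlinarith [hy.1, hy.2]
  -- a zero of `f1`
  obtain ⟨z, hz, hz0⟩ : ∃ z ∈ Ioo (-1 : ℝ) 1, f1 z = 0 :=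
    exists_hasDerivAt_eq_zero (by norm_num) c0 (by rw [hl, hr]) d0
  have hzI : z ∈ Icc (-1 : ℝ) 1 := Ioo_subset_Icc_self hz
  have bp : ∀ y ∈ Icc (-1 : ℝ) 1, f1 y ^ 2 ≤ 2 * D2 := by
    intro y hy
    have h1 := sq_sub_le c1 d1 c2 hzI hy
    rw [hz0, sub_zero] at h1
    have : |y - z| ≤ 2 := abs_le.mpr ⟨by linarith [hy.1, hzI.2], by linarith [hy.2, hzI.1]⟩
    exact h1.trans (mul_le_mul_of_nonneg_right this hD20)
  have bp4 : ∀ y ∈ Icc (-1 : ℝ) 1, f1 y ^ 4 ≤ 4 * (1 / 1000) ^ 2 * D2 := by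
    intro y hy
    refine (pow_four_le_of_zero c1 d1 c2 hzI hy hz0).trans ?_
    exact mul_le_mul_of_nonneg_right (by linarith) hD20
  -- Integrating from the nearer end gives the factor 1 - |y|, which is at most 1 - y².
  have bF : ∀ y ∈ Icc (-1 : ℝ) 1, (f0 y - 1) ^ 2 ≤ (1 / 1000) ^ 2 * (1 - y ^ 2) := by
    intro y hy
    have h1 := sq_sub_le c0 d0 c1 hml hy
    have h2 := sq_sub_le c0 d0 c1 hmr hy
    rw [hl, abs_of_nonneg (by linarith [hy.1])] at h1
    rw [hr, abs_of_nonpos (by linarith [hy.2])] at h2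
    have h3 := hy.1
    have h4 := hy.2
    rw [← hq] at h1 h2
    rcases le_total 0 y with h | h <;> nlinarith
  -- Integrate the derivative of w f2² from -1, where w vanishes; no unweighted third derivative is
  -- needed.
  have bh : ∀ y ∈ Icc (-1 : ℝ) 1, (1 - y ^ 2) / 2 * f2 y ^ 2 ≤ 2 * (D2 + D3) := by
    intro y hy
    have hsub : Icc (-1) y ⊆ Icc (-1 : ℝ) 1 := Icc_subset_Icc le_rfl hy.2
    have cc : ContinuousOn (fun s => -s * f2 s ^ 2 + (1 - s ^ 2) / 2 * (2 * f2 s * f3 s))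
        (Icc (-1) 1) :=
      (continuousOn_id.neg.mul (c2.pow 2)).add (cw.mul ((continuousOn_const.mul c2).mul c3))
    have hint : ∫ s in (-1)..y, (-s * f2 s ^ 2 + (1 - s ^ 2) / 2 * (2 * f2 s * f3 s)) =
        (1 - y ^ 2) / 2 * f2 y ^ 2 - (1 - (-1) ^ 2) / 2 * f2 (-1) ^ 2 := by
      apply intervalIntegral.integral_eq_sub_of_hasDerivAt_of_le hy.1
        (f := fun s => (1 - s ^ 2) / 2 * f2 s ^ 2)
      · exact (cw.mul (c2.pow 2)).mono hsub
      · intro s hs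
        have hs' : s ∈ Ioo (-1 : ℝ) 1 := ⟨hs.1, lt_of_lt_of_le hs.2 hy.2⟩
        have e1 : HasDerivAt (fun s : ℝ => (1 - s ^ 2) / 2) (-s) s := by
          have := (((hasDerivAt_id s).pow 2).const_sub 1).div_const 2
          exact this.congr_deriv (by simp; ring)
        exact (e1.mul ((d2 s hs').pow 2)).congr_deriv (by simp only [Pi.pow_apply]; push_cast; ring)
      · apply ContinuousOn.intervalIntegrable
        rw [uIcc_of_le hy.1]; exact cc.mono hsub
    have hz' : (1 - (-1 : ℝ) ^ 2) / 2 * f2 (-1) ^ 2 = 0 := by norm_num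
    rw [hz', sub_zero] at hint
    rw [← hint]
    have cb : ContinuousOn (fun s => 2 * f2 s ^ 2 + (1 - s ^ 2) / 2 * f3 s ^ 2) (Icc (-1) 1) :=
      (continuousOn_const.mul (c2.pow 2)).add (cw.mul (c3.pow 2))
    calc ∫ s in (-1)..y, (-s * f2 s ^ 2 + (1 - s ^ 2) / 2 * (2 * f2 s * f3 s))
        ≤ ∫ s in (-1)..y, (2 * f2 s ^ 2 + (1 - s ^ 2) / 2 * f3 s ^ 2) := by
          apply intervalIntegral.integral_mono_on hy.1
          · apply ContinuousOn.intervalIntegrable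
            rw [uIcc_of_le hy.1]; exact cc.mono hsub
          · apply ContinuousOn.intervalIntegrable
            rw [uIcc_of_le hy.1]; exact cb.mono hsub
          · intro s hs
            have hs' := hsub hs
            have h1 := hysq s hs'
            have h2 := mul_nonneg (by linarith : 0 ≤ (1 - s ^ 2) / 2) (sq_nonneg (f2 s - f3 s))
            have h3 := mul_nonneg (by linarith [hs'.1] : 0 ≤ 1 + s) (sq_nonneg (f2 s))
            have h4 := mul_nonneg (sq_nonneg s) (sq_nonneg (f2 s))
            have h5 := sq_nonneg (f2 s)
            nlinarith
      _ ≤ ∫ s in (-1)..1, (2 * f2 s ^ 2 + (1 - s ^ 2) / 2 * f3 s ^ 2) := by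
          apply intervalIntegral.integral_mono_interval le_rfl hy.1 hy.2
          · refine (ae_restrict_iff' measurableSet_Ioc).mpr (Eventually.of_forall fun s hs => ?_)
            have h1 := hysq s (Ioc_subset_Icc_self hs)
            have h2 := mul_nonneg (by linarith : 0 ≤ (1 - s ^ 2) / 2) (sq_nonneg (f3 s))
            have h3 := sq_nonneg (f2 s)
            simp only [Pi.zero_apply]; linarith
          · exact II cb
      _ = 2 * D2 + D3 := by
          rw [intervalIntegral.integral_add i22 i33, intervalIntegral.integral_const_mul]
      _ ≤ 2 * (D2 + D3) := by linarith
  -- the flux and the dissipation identity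
  set R : ℝ → ℝ := fun y =>
    -((1 - y ^ 2) / 2) * f0 y ^ 5 * f3 y ^ 2 - 8 * f0 y ^ 5 * f2 y ^ 2
      + 16 / 5 * (f0 y ^ 5 - 1) * (f2 y ^ 2 + 2 * y * f2 y * f3 y) - 25 * f0 y ^ 4 * f1 y ^ 2 * f2 y
      - 6 * ((1 - y ^ 2) / 2) * f0 y ^ 4 * f1 y * f2 y * f3 y
      - (1 - y ^ 2) / 2 * f0 y ^ 3 * f1 y ^ 3 * f3 y
      - 14 * y * f0 y ^ 3 * f1 y ^ 3 * f2 y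
      - 8 * ((1 - y ^ 2) / 2) * f0 y ^ 3 * f1 y ^ 2 * f2 y ^ 2
      - 2 * ((1 - y ^ 2) / 2) * f0 y ^ 2 * f1 y ^ 4 * f2 y with hR
  -- The last term of `P` is a corrector. Without it `R` would contain -16 y F⁴ F_y F_yy², which has
  -- no weight and no small pointwise factor. Writing 5 F⁴ F_y = (F⁵ - 1)_y and integrating by parts
  -- replaces it by terms with the small factor F⁵ - 1, which vanishes at ±1.
  set P : ℝ → ℝ := fun y =>
    f1 y * ft y + f0 y ^ 2 * f2 y * velocityExpr y (f0 y) (f1 y) (f2 y) (f3 y)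
      + 2 * y * f0 y ^ 5 * f2 y ^ 2 + 6 * f0 y ^ 5 * f1 y * f2 y
      + 7 * y * f0 y ^ 4 * f1 y ^ 2 * f2 y - 16 / 5 * y * (f0 y ^ 5 - 1) * f2 y ^ 2 with hP
  have cR : ContinuousOn R (Icc (-1) 1) := by simp only [hR]; fun_prop
  have cP : ContinuousOn P (Icc (-1) 1) := by simp only [hP, velocityExpr]; fun_prop
  have cft : ContinuousOn (fun y => f1 y * ft1 y) (Icc (-1) 1) := c1.mul ct1
  have dP : ∀ y ∈ Ioo (-1 : ℝ) 1, HasDerivAt P (f1 y * ft1 y - R y) y := by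
    intro y hy
    have e0 := d0 y hy
    have e1 := d1 y hy
    have e2 := d2 y hy
    have en : HasDerivAt (fun y => velocityExpr y (f0 y) (f1 y) (f2 y) (f3 y)) (n1 y) y := by
      apply (dn y hy).congr_of_eventuallyEq
      filter_upwards [isOpen_Ioo.mem_nhds hy] with s hs using (hn s hs).symm
    have ey := hasDerivAt_id' y
    have key := (((((e1.mul (dt y hy)).add (((e0.pow 2).mul e2).mul en)).add
      (((ey.const_mul 2).mul (e0.pow 5)).mul (e2.pow 2))).add
      ((((e0.pow 5).const_mul 6).mul e1).mul e2)).add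
      ((((ey.const_mul 7).mul (e0.pow 4)).mul (e1.pow 2)).mul e2)).sub
      (((ey.const_mul (16 / 5)).mul ((e0.pow 5).sub_const 1)).mul (e2.pow 2))
    refine key.congr_deriv ?_
    have h1 := hn y hy
    simp only [hR, ht y hy, Pi.mul_apply, Pi.pow_apply, velocityExpr]
    push_cast
    ring
  have hint : ∫ y in (-1)..1, (f1 y * ft1 y - R y) = P 1 - P (-1) :=
    intervalIntegral.integral_eq_sub_of_hasDerivAt_of_le hle cP dP (II (cft.sub cR))
  rw [intervalIntegral.integral_sub (II cft) (II cR)] at hint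
  -- At y = ±1 we have w = 0, F = 1 and F_t = 0. The products with F_y cancel, leaving squares whose
  -- total contribution to P(1) - P(-1) is nonpositive.
  have hP1 : P 1 = -2 * f2 1 ^ 2 := by
    simp only [hP, velocityExpr, hr, htr]; ring
  have hPm1 : P (-1) = 2 * f2 (-1) ^ 2 := by
    simp only [hP, velocityExpr, hl, htl]; ring
  have hRle : ∫ y in (-1)..1, R y ≤ ∫ y in (-1)..1, (-(1 / 2) *
      ((1 - y ^ 2) / 2 * f3 y ^ 2 + f2 y ^ 2) + 100000 * (D2 + D3) * f1 y ^ 2) := by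
    apply intervalIntegral.integral_mono_on hle (II cR)
    · apply II; fun_prop
    · intro y hy
      exact dissipation_integrand_le (hysq y hy) (bF y hy) (by linarith)
        ((bp y hy).trans (by linarith)) ((bp4 y hy).trans (by nlinarith)) (bh y hy)
  rw [intervalIntegral.integral_add (II (by fun_prop)) (II (by fun_prop)),
    intervalIntegral.integral_const_mul, intervalIntegral.integral_const_mul,
    intervalIntegral.integral_add i33 (II (by fun_prop)), ← hq, ← hD2, ← hD3] at hRle
  have hpoin : q ≤ 4 * D2 := by
    have : q ≤ ∫ y in (-1 : ℝ)..1, 2 * D2 :=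
      intervalIntegral.integral_mono_on hle (II (c1.pow 2)) (II continuousOn_const) bp
    rw [intervalIntegral.integral_const, smul_eq_mul] at this
    linarith
  have h1 := sq_nonneg (f2 1)
  have h2 := sq_nonneg (f2 (-1))
  have h3 : (D2 + D3) * q ≤ (D2 + D3) * (1 / 1000) ^ 2 :=
    mul_le_mul_of_nonneg_left hsmall (by linarith)
  -- By smallness 10⁵ (D2 + D3) q ≤ (1/10)(D2 + D3), so the right-hand side is at most -(4/10)(D2 +
  -- D3). Poincaré turns this into -q/10, better than -q/16.
  linarith

/-! ### Smoothness of integrals depending on a parameter -/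

theorem continuous_section {E G : Type} [TopologicalSpace E] [TopologicalSpace G] {O : Set E}
    {f : E × ℝ → G} (hf : ContinuousOn f (O ×ˢ univ)) {x : E} (hx : x ∈ O) :
    Continuous fun σ => f (x, σ) := by
  rw [← continuousOn_univ]
  exact hf.comp (by fun_prop) fun σ _ => ⟨hx, mem_univ _⟩

section ParametricIntegral

variable {E : Type} [NormedAddCommGroup E] [NormedSpace ℝ E] [FiniteDimensional ℝ E]

/-- Local uniform bounds for a continuous function of a parameter and a variable in `[a, b]`. -/
theorem exists_bound_near {G : Type} [NormedAddCommGroup G] {O : Set E} (hO : IsOpen O)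
    {f : E × ℝ → G} (hf : ContinuousOn f (O ×ˢ univ)) (a b : ℝ) {x : E} (hx : x ∈ O) :
    ∃ s ∈ 𝓝 x, s ⊆ O ∧ ∃ K, ∀ y ∈ s, ∀ σ ∈ uIcc a b, ‖f (y, σ)‖ ≤ K := by
  have : ProperSpace E := FiniteDimensional.proper ℝ E
  obtain ⟨s, hs, hsO, hsc⟩ := local_compact_nhds (hO.mem_nhds hx)
  obtain ⟨K, hK⟩ := (hsc.prod (isCompact_uIcc (a := a) (b := b))).exists_bound_of_continuousOn
    (hf.mono (prod_mono hsO (subset_univ _)))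
  exact ⟨s, hs, hsO, K, fun y hy σ hσ => hK (y, σ) ⟨hy, hσ⟩⟩

theorem hasFDerivAt_intervalIntegral {G : Type} [NormedAddCommGroup G] [NormedSpace ℝ G]
    {O : Set E} (hO : IsOpen O) {f : E × ℝ → G}
    (hf : ContDiffOn ℝ 1 f (O ×ˢ univ)) (a b : ℝ) {x : E} (hx : x ∈ O) :
    HasFDerivAt (fun x => ∫ σ in a..b, f (x, σ))
      (∫ σ in a..b, (fderiv ℝ f (x, σ)).comp (ContinuousLinearMap.inl ℝ E ℝ)) x := by
  have hOo : IsOpen (O ×ˢ (univ : Set ℝ)) := hO.prod isOpen_univ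
  have hf' : ContinuousOn (fun p => (fderiv ℝ f p).comp (ContinuousLinearMap.inl ℝ E ℝ))
      (O ×ˢ univ) := by
    have := hf.continuousOn_fderiv_of_isOpen hOo le_rfl
    exact this.clm_comp continuousOn_const
  obtain ⟨s, hs, hsO, K, hK⟩ := exists_bound_near hO hf' a b hx
  refine intervalIntegral.hasFDerivAt_integral_of_dominated_of_fderiv_le
    (F := fun x σ => f (x, σ)) (bound := fun _ => K)
    (F' := fun x σ => (fderiv ℝ f (x, σ)).comp (ContinuousLinearMap.inl ℝ E ℝ)) hs ?_ ?_ ?_ ?_ ?_ ?_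
  · filter_upwards [hs] with y hy
    exact (continuous_section hf.continuousOn (hsO hy)).aestronglyMeasurable
  · exact (continuous_section hf.continuousOn hx).intervalIntegrable _ _
  · exact (continuous_section hf' hx).aestronglyMeasurable
  · exact Eventually.of_forall fun σ hσ y hy => hK y hy σ (uIoc_subset_uIcc hσ)
  · exact continuous_const.intervalIntegrable _ _
  · refine Eventually.of_forall fun σ _ y hy => ?_
    have h1 : HasFDerivAt f (fderiv ℝ f (y, σ)) (y, σ) :=
      ((hf.differentiableOn (by norm_num)).differentiableAt
        (hOo.mem_nhds ⟨hsO hy, mem_univ _⟩)).hasFDerivAt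
    have h2 : HasFDerivAt (fun y : E => (y, σ)) (ContinuousLinearMap.inl ℝ E ℝ) y :=
      hasFDerivAt_prodMk_left y σ
    exact h1.comp y h2

/-- The derivative of the integral is the integral of the partial derivative, with values in a space
of continuous linear maps. The induction therefore quantifies over the target space `G`. -/
theorem contDiffOn_nat_intervalIntegral (n : ℕ) :
    ∀ {G : Type} [NormedAddCommGroup G] [NormedSpace ℝ G] {O : Set E} (_ : IsOpen O)
    {f : E × ℝ → G} (_ : ContDiffOn ℝ ∞ f (O ×ˢ univ)) (a b : ℝ),
    ContDiffOn ℝ n (fun x => ∫ σ in a..b, f (x, σ)) O := by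
  induction n with
  | zero =>
    intro G _ _ O hO f hf a b
    rw [Nat.cast_zero, contDiffOn_zero]
    intro x hx
    exact (hasFDerivAt_intervalIntegral hO (hf.of_le (by norm_cast)) a b
      hx).continuousAt.continuousWithinAt
  | succ n ih =>
    intro G _ _ O hO f hf a b
    have hOo : IsOpen (O ×ˢ (univ : Set ℝ)) := hO.prod isOpen_univ
    have hd : ∀ x ∈ O, _ := fun x hx =>
      hasFDerivAt_intervalIntegral hO (hf.of_le (by norm_cast)) a b hx
    push_cast
    rw [contDiffOn_succ_iff_fderiv_of_isOpen hO]
    refine ⟨fun x hx => (hd x hx).differentiableAt.differentiableWithinAt, by simp, ?_⟩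
    have h1 : ContDiffOn ℝ ∞ (fun p => (fderiv ℝ f p).comp (ContinuousLinearMap.inl ℝ E ℝ))
        (O ×ˢ univ) :=
      (hf.fderiv_of_isOpen hOo (m := ∞) le_rfl).clm_comp contDiffOn_const
    exact (ih hO h1 a b).congr fun x hx => (hd x hx).fderiv

theorem contDiffOn_intervalIntegral {G : Type} [NormedAddCommGroup G] [NormedSpace ℝ G]
    {O : Set E} (hO : IsOpen O) {f : E × ℝ → G} (hf : ContDiffOn ℝ ∞ f (O ×ˢ univ)) (a b : ℝ) :
    ContDiffOn ℝ ∞ (fun x => ∫ σ in a..b, f (x, σ)) O :=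
  contDiffOn_infty.mpr fun n => contDiffOn_nat_intervalIntegral n hO hf a b

end ParametricIntegral

/-! ### Space-time calculus at positive times -/

/-- The space-time domain of positive times. -/
def posTime : Set (ℝ × ℝ) := Ioi 0 ×ˢ univ

theorem isOpen_posTime : IsOpen posTime := isOpen_Ioi.prod isOpen_univ

theorem mem_posTime {t x : ℝ} (ht : 0 < t) : (t, x) ∈ posTime := ⟨ht, mem_univ _⟩

/-- Time derivative of a function of `(t, x)`. -/
def dT (U : ℝ × ℝ → ℝ) (p : ℝ × ℝ) : ℝ := fderiv ℝ U p (1, 0)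

/-- Space derivative of a function of `(t, x)`. -/
def dX (U : ℝ × ℝ → ℝ) (p : ℝ × ℝ) : ℝ := fderiv ℝ U p (0, 1)

section

variable {U : ℝ × ℝ → ℝ} (hU : ContDiffOn ℝ ∞ U posTime)
include hU

theorem contDiffOn_dT : ContDiffOn ℝ ∞ (dT U) posTime :=
  (hU.fderiv_of_isOpen isOpen_posTime (m := ∞) le_rfl).clm_apply contDiffOn_const

theorem contDiffOn_dX : ContDiffOn ℝ ∞ (dX U) posTime :=
  (hU.fderiv_of_isOpen isOpen_posTime (m := ∞) le_rfl).clm_apply contDiffOn_const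

theorem hasFDerivAt_posTime {p : ℝ × ℝ} (hp : p ∈ posTime) : HasFDerivAt U (fderiv ℝ U p) p :=
  ((hU.differentiableOn (by simp)).differentiableAt (isOpen_posTime.mem_nhds hp)).hasFDerivAt

/-- Chain rule along a curve. -/
theorem hasDerivAt_along {b : ℝ → ℝ} {b' t : ℝ} (ht : 0 < t) (hb : HasDerivAt b b' t) :
    HasDerivAt (fun s => U (s, b s)) (dT U (t, b t) + b' * dX U (t, b t)) t := by
  have h := (hasFDerivAt_posTime hU (mem_posTime (x := b t) ht)).comp_hasDerivAt t
    ((hasDerivAt_id t).prodMk hb)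
  refine h.congr_deriv ?_
  have : ((1 : ℝ), b') = (1, 0) + b' • (0, 1) := by simp
  rw [this, map_add, map_smul]; rfl

theorem hasDerivAt_dT {t : ℝ} (ht : 0 < t) (x : ℝ) :
    HasDerivAt (fun s => U (s, x)) (dT U (t, x)) t := by
  simpa using hasDerivAt_along hU ht (hasDerivAt_const t x)

theorem hasDerivAt_dX {t : ℝ} (ht : 0 < t) (x : ℝ) :
    HasDerivAt (fun z => U (t, z)) (dX U (t, x)) x :=
  ((hasFDerivAt_posTime hU (mem_posTime (x := x) ht)).comp_hasDerivAt x
    ((hasDerivAt_const x t).prodMk (hasDerivAt_id x)))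

theorem continuous_slice {t : ℝ} (ht : 0 < t) : Continuous fun x => U (t, x) :=
  continuous_section hU.continuousOn (E := ℝ) (O := Ioi 0) ht

/-- Rescaling the interval from c to x onto [0, 1] turns the variable end point into a smooth
parameter of the integrand. -/
theorem contDiffOn_primitive (c : ℝ) :
    ContDiffOn ℝ ∞ (fun p : ℝ × ℝ => ∫ z in c..p.2, U (p.1, z)) posTime := by
  have e : ∀ p : ℝ × ℝ, ∫ z in c..p.2, U (p.1, z) =
      (p.2 - c) * ∫ σ in (0 : ℝ)..1, U (p.1, c + (p.2 - c) * σ) := by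
    intro p
    have := intervalIntegral.smul_integral_comp_add_mul (a := 0) (b := 1)
      (fun z => U (p.1, z)) (p.2 - c) c
    simp only [smul_eq_mul, mul_zero, add_zero, mul_one] at this
    rw [this]; congr 1; ring
  simp_rw [e]
  refine (contDiffOn_snd.sub contDiffOn_const).mul ?_
  apply contDiffOn_intervalIntegral isOpen_posTime
    (f := fun q : (ℝ × ℝ) × ℝ => U (q.1.1, c + (q.1.2 - c) * q.2))
  apply hU.comp (ContDiff.contDiffOn (by fun_prop))
  intro q hq
  exact ⟨hq.1.1, mem_univ _⟩

/-- Leibniz' rule with moving end points. -/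
theorem hasDerivAt_integral_moving {a b : ℝ → ℝ} {a' b' t : ℝ} (ht : 0 < t)
    (ha : HasDerivAt a a' t) (hb : HasDerivAt b b' t) :
    HasDerivAt (fun s => ∫ z in (a s)..(b s), U (s, z))
      (b' * U (t, b t) - a' * U (t, a t) + ∫ z in (a t)..(b t), dT U (t, z)) t := by
  have key : ∀ {b : ℝ → ℝ} {b' : ℝ}, HasDerivAt b b' t →
      HasDerivAt (fun s => ∫ z in 0..(b s), U (s, z))
        (b' * U (t, b t) + ∫ z in 0..(b t), dT U (t, z)) t := by
    intro b b' hb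
    have h := hasDerivAt_along (contDiffOn_primitive hU 0) ht hb
    refine h.congr_deriv ?_
    rw [add_comm]
    congr 1
    · congr 1
      have h1 := hasDerivAt_dX (contDiffOn_primitive hU 0) ht (b t)
      have h2 := intervalIntegral.integral_hasDerivAt_right
        ((continuous_slice hU ht).intervalIntegrable 0 (b t))
        (continuous_slice hU ht).stronglyMeasurable.stronglyMeasurableAtFilter
        (continuous_slice hU ht).continuousAt
      exact h1.unique h2
    · have h1 := hasDerivAt_dT (contDiffOn_primitive hU 0) ht (b t)
      have h2 := (hasFDerivAt_intervalIntegral (isOpen_Ioi (a := (0 : ℝ))) (f := U)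
        (hU.of_le (by norm_cast)) 0 (b t) ht).hasDerivAt
      rw [h1.unique h2]
      rw [ContinuousLinearMap.intervalIntegral_apply]
      · rfl
      · apply Continuous.intervalIntegrable
        have hf := (hU.fderiv_of_isOpen isOpen_posTime (m := ∞) le_rfl).continuousOn
        exact (continuous_section (E := ℝ) (O := Ioi 0) hf ht).clm_comp continuous_const
  have h := (key hb).sub (key ha)
  have e : ∀ s, 0 < s → ∫ z in (a s)..(b s), U (s, z) =
      (∫ z in 0..(b s), U (s, z)) - ∫ z in 0..(a s), U (s, z) := by
    intro s hs
    rw [intervalIntegral.integral_interval_sub_left] <;>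
      exact (continuous_slice hU hs).intervalIntegrable _ _
  have e' : ∫ z in (a t)..(b t), dT U (t, z) =
      (∫ z in 0..(b t), dT U (t, z)) - ∫ z in 0..(a t), dT U (t, z) := by
    rw [intervalIntegral.integral_interval_sub_left] <;>
      exact (continuous_slice (contDiffOn_dT hU) ht).intervalIntegrable _ _
  refine (h.congr_deriv (by rw [e']; ring)).congr_of_eventuallyEq ?_
  filter_upwards [Ioi_mem_nhds ht] with s hs using e s hs

end

/-! ### Desingularisation of the mass coordinate at a contact point -/

/-- The quotient `ξ⁻² ∫₀^ξ V(t, s) ds`, extended smoothly to `ξ = 0` for `V(t, 0) = 0`. -/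
def quadQuot (V : ℝ × ℝ → ℝ) (p : ℝ × ℝ) : ℝ :=
  ∫ σ in (0 : ℝ)..1, (1 - σ) * dX V (p.1, p.2 * σ)

theorem contDiffOn_quadQuot {V : ℝ × ℝ → ℝ} (hV : ContDiffOn ℝ ∞ V posTime) :
    ContDiffOn ℝ ∞ (quadQuot V) posTime := by
  apply contDiffOn_intervalIntegral isOpen_posTime
    (f := fun q : (ℝ × ℝ) × ℝ => (1 - q.2) * dX V (q.1.1, q.1.2 * q.2))
  refine ContDiffOn.mul (ContDiff.contDiffOn (by fun_prop)) ?_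
  apply (contDiffOn_dX hV).comp (ContDiff.contDiffOn (by fun_prop))
  intro q hq
  exact ⟨hq.1.1, mem_univ _⟩

/-- Taylor's formula with integral remainder for the primitive of V, obtained by integrating the
derivative of (1 - σ) V(t, ξσ) over [0, 1]. -/
theorem integral_eq_sq_mul_quadQuot {V : ℝ × ℝ → ℝ} (hV : ContDiffOn ℝ ∞ V posTime) {t : ℝ}
    (ht : 0 < t) (h0 : V (t, 0) = 0) (ξ : ℝ) :
    ∫ s in 0..ξ, V (t, s) = ξ ^ 2 * quadQuot V (t, ξ) := by
  have c1 : Continuous fun σ : ℝ => V (t, ξ * σ) :=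
    (continuous_slice hV ht).comp (by fun_prop)
  have c2 : Continuous fun σ : ℝ => dX V (t, ξ * σ) :=
    (continuous_slice (contDiffOn_dX hV) ht).comp (by fun_prop)
  have c3 : Continuous fun σ : ℝ => ξ * ((1 - σ) * dX V (t, ξ * σ)) :=
    continuous_const.mul ((continuous_const.sub continuous_id).mul c2)
  have h1 : ∫ σ in (0 : ℝ)..1, (ξ * ((1 - σ) * dX V (t, ξ * σ)) - V (t, ξ * σ)) =
      (1 - 1) * V (t, ξ * 1) - (1 - 0) * V (t, ξ * 0) := by
    apply intervalIntegral.integral_eq_sub_of_hasDerivAt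
      (f := fun σ => (1 - σ) * V (t, ξ * σ))
    · intro σ _
      have h2 := (hasDerivAt_dX hV ht (ξ * σ)).comp σ ((hasDerivAt_id σ).const_mul ξ)
      have h3 := ((hasDerivAt_id σ).const_sub 1).mul h2
      refine h3.congr_deriv ?_
      simp only [id, Function.comp]
      ring
    · exact (c3.sub c1).intervalIntegrable _ _
  rw [intervalIntegral.integral_sub (c3.intervalIntegrable _ _) (c1.intervalIntegrable _ _),
    intervalIntegral.integral_const_mul] at h1
  simp only [mul_zero, h0, sub_self, zero_mul] at h1
  have h4 := intervalIntegral.smul_integral_comp_mul_left (a := 0) (b := 1)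
    (fun s => V (t, s)) ξ
  simp only [smul_eq_mul, mul_zero, mul_one] at h4
  rw [← h4]
  have : quadQuot V (t, ξ) = ∫ σ in (0 : ℝ)..1, (1 - σ) * dX V (t, ξ * σ) := rfl
  rw [this]
  linear_combination (-ξ) * h1

theorem quadQuot_zero {V : ℝ × ℝ → ℝ} {t : ℝ} (h1 : dX V (t, 0) = 1) :
    quadQuot V (t, 0) = 1 / 2 := by
  simp only [quadQuot, zero_mul, h1, mul_one]
  rw [intervalIntegral.integral_sub (by simp) (by simp)]
  simp; norm_num

theorem isInvertible_of_apply_one_ne_zero {L : ℝ →L[ℝ] ℝ} (h : L 1 ≠ 0) : L.IsInvertible := by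
  refine ⟨ContinuousLinearEquiv.smulLeft (Units.mk0 (L 1) h), ?_⟩
  ext
  simp

/-- The data of a film profile near one of its contact points: `V(t, ξ)` is the height at distance
`ξ` from the contact point, and `ζ(t, d)` the distance at which the mass equals the mass of the
stationary profile at distance `d` from its contact point. -/
structure ContactData (V ζ : ℝ × ℝ → ℝ) : Prop where
  smooth : ContDiffOn ℝ ∞ V posTime
  zero : ∀ t, 0 < t → V (t, 0) = 0
  slope : ∀ t, 0 < t → dX V (t, 0) = 1
  cont : ContinuousOn ζ (Ioi 0 ×ˢ Ico 0 2)
  nonneg : ∀ t, 0 < t → ∀ d ∈ Ico (0 : ℝ) 2, 0 ≤ ζ (t, d)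
  pos : ∀ t, 0 < t → ∀ d ∈ Ico (0 : ℝ) 2, ∀ s ∈ Ioc 0 (ζ (t, d)), 0 < V (t, s)
  mass : ∀ t, 0 < t → ∀ d ∈ Ico (0 : ℝ) 2, ∫ s in 0..(ζ (t, d)), V (t, s) = d ^ 2 * (3 - d) / 6

namespace ContactData

variable {V ζ : ℝ × ℝ → ℝ} (H : ContactData V ζ)
include H

theorem quadQuot_pos {t d : ℝ} (ht : 0 < t) (hd : d ∈ Ico (0 : ℝ) 2) :
    0 < quadQuot V (t, ζ (t, d)) := by
  rcases (H.nonneg t ht d hd).eq_or_lt with h | h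
  · rw [← h, quadQuot_zero (H.slope t ht)]; norm_num
  · have h1 : 0 < ∫ s in 0..(ζ (t, d)), V (t, s) := by
      apply intervalIntegral.intervalIntegral_pos_of_pos_on _ _ h
      · exact (continuous_slice H.smooth ht).intervalIntegrable _ _
      · intro s hs; exact H.pos t ht d hd s ⟨hs.1, hs.2.le⟩
    rw [integral_eq_sq_mul_quadQuot H.smooth ht (H.zero t ht)] at h1
    exact pos_of_mul_pos_right h1 (sq_nonneg _)

/-- This is the square root of the mass balance. Both masses are quadratic at the contact point, so
their roots are nondegenerate there and the implicit function theorem becomes applicable. -/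
theorem relation {t d : ℝ} (ht : 0 < t) (hd : d ∈ Ico (0 : ℝ) 2) :
    ζ (t, d) * √(quadQuot V (t, ζ (t, d))) = d * √((3 - d) / 6) := by
  have h1 := H.mass t ht d hd
  rw [integral_eq_sq_mul_quadQuot H.smooth ht (H.zero t ht)] at h1
  have h2 := congrArg Real.sqrt h1
  rw [Real.sqrt_mul (sq_nonneg _), Real.sqrt_sq (H.nonneg t ht d hd), mul_div_assoc,
    Real.sqrt_mul (sq_nonneg _), Real.sqrt_sq hd.1] at h2
  exact h2

/-- Solve ξ √A(t, ξ) = d √((3 - d)/6) for ξ, where A is `quadQuot V`. This equation is smooth and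
nondegenerate up to and including d = 0. Only the opposite contact point, d = 2, is left out. -/
theorem contDiffOn : ContDiffOn ℝ ∞ ζ (Ioi 0 ×ˢ Ico 0 2) := by
  rintro ⟨t, d⟩ ⟨ht, hd⟩
  simp only [mem_Ioi] at ht
  simp only at hd
  set f : (ℝ × ℝ) × ℝ → ℝ := fun v =>
    v.2 * √(quadQuot V (v.1.1, v.2)) - v.1.2 * √((3 - v.1.2) / 6) with hf
  set u : (ℝ × ℝ) × ℝ := ((t, d), ζ (t, d)) with hu
  have hA := H.quadQuot_pos ht hd
  have hAs : ContDiffAt ℝ ∞ (quadQuot V) (t, ζ (t, d)) :=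
    (contDiffOn_quadQuot H.smooth).contDiffAt (isOpen_posTime.mem_nhds (mem_posTime ht))
  have cdf : ContDiffAt ℝ ∞ f u := by
    have h1 : ContDiffAt ℝ ∞ (fun v : (ℝ × ℝ) × ℝ => quadQuot V (v.1.1, v.2)) u :=
      ContDiffAt.comp u (g := quadQuot V) (f := fun v : (ℝ × ℝ) × ℝ => (v.1.1, v.2)) hAs
        (by fun_prop)
    have h2 : ContDiffAt ℝ ∞ (fun v : (ℝ × ℝ) × ℝ => (3 - v.1.2) / 6) u := by fun_prop
    exact (contDiffAt_snd.mul (h1.sqrt hA.ne')).sub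
      ((contDiffAt_snd.comp u contDiffAt_fst).mul
        (h2.sqrt (by have := hd.2; simp only [hu]; apply ne_of_gt; linarith)))
  have hf0 : f u = 0 := by simp only [hf, hu, H.relation ht hd, sub_self]
  have hder : HasDerivAt (fun ξ => f ((t, d), ξ)) (fderiv ℝ f u (0, 1)) (ζ (t, d)) :=
    (cdf.differentiableAt (by simp)).hasFDerivAt.comp_hasDerivAt (ζ (t, d))
      ((hasDerivAt_const _ (t, d)).prodMk (hasDerivAt_id _))
  have hG : HasDerivAt (fun ξ => ξ * √(quadQuot V (t, ξ))) (fderiv ℝ f u (0, 1)) (ζ (t, d)) := by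
    have := hder.add_const (d * √((3 - d) / 6))
    refine this.congr_of_eventuallyEq (Eventually.of_forall fun ξ => ?_)
    simp [hf]
  -- At ξ = 0 the derivative of ξ √A is √(1/2). For ξ > 0 the square ξ² A is the mass, with
  -- derivative V > 0, so the derivative of its root cannot vanish.
  have hne : fderiv ℝ f u (0, 1) ≠ 0 := by
    have hcA : ContinuousAt (fun ξ => quadQuot V (t, ξ)) (ζ (t, d)) :=
      (continuous_slice (contDiffOn_quadQuot H.smooth) ht).continuousAt
    rcases (H.nonneg t ht d hd).eq_or_lt with h | h
    · have hA0 : DifferentiableAt ℝ (fun ξ => √(quadQuot V (t, ξ))) (ζ (t, d)) :=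
        ((hasDerivAt_dX (contDiffOn_quadQuot H.smooth) ht _).sqrt hA.ne').differentiableAt
      have h1 := (hasDerivAt_id (ζ (t, d))).mul hA0.hasDerivAt
      have h2 := hG.unique h1
      rw [h2]
      simp only [id, one_mul, ← h, zero_mul, add_zero, quadQuot_zero (H.slope t ht)]
      positivity
    · have h1 : HasDerivAt (fun ξ => ∫ s in 0..ξ, V (t, s)) (V (t, ζ (t, d))) (ζ (t, d)) :=
        intervalIntegral.integral_hasDerivAt_right
          ((continuous_slice H.smooth ht).intervalIntegrable 0 _)
          (continuous_slice H.smooth ht).stronglyMeasurable.stronglyMeasurableAtFilter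
          (continuous_slice H.smooth ht).continuousAt
      have h2 : HasDerivAt (fun ξ => ∫ s in 0..ξ, V (t, s)) _ (ζ (t, d)) :=
        (hG.pow 2).congr_of_eventuallyEq (by
          filter_upwards [hcA.eventually (lt_mem_nhds hA)] with ξ hξ
          rw [integral_eq_sq_mul_quadQuot H.smooth ht (H.zero t ht)]
          simp only [Pi.pow_apply]
          rw [mul_pow, Real.sq_sqrt hξ.le])
      have h3 := h1.unique h2
      have h4 := H.pos t ht d hd _ ⟨h, le_rfl⟩
      intro h5
      rw [h5, mul_zero] at h3
      exact h4.ne' h3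
  have hinv : (fderiv ℝ f u ∘L .inr ℝ (ℝ × ℝ) ℝ).IsInvertible :=
    isInvertible_of_apply_one_ne_zero (by simpa using hne)
  have hψ := cdf.contDiffAt_implicitFunction (by simp) hinv
  have hiff := cdf.eventually_apply_eq_iff_implicitFunction (by simp) hinv
  set ψ := cdf.implicitFunction (by simp) hinv
  -- The assumed continuity of `ζ` keeps it in the neighbourhood where the solution is unique, which
  -- identifies it with the implicit function, also at the one-sided point d = 0.
  have hcurve : Tendsto (fun p : ℝ × ℝ => (p, ζ p)) (𝓝[Ioi 0 ×ˢ Ico 0 2] (t, d)) (𝓝 u) := by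
    rw [hu, nhds_prod_eq]
    exact tendsto_nhdsWithin_of_tendsto_nhds tendsto_id |>.prodMk (H.cont (t, d) ⟨ht, hd⟩)
  have heq : ζ =ᶠ[𝓝[Ioi 0 ×ˢ Ico 0 2] (t, d)] ψ := by
    filter_upwards [hcurve.eventually hiff, self_mem_nhdsWithin] with p hp hpS
    have : f (p, ζ p) = f u := by
      rw [hf0]
      simp only [hf]
      rw [H.relation hpS.1 hpS.2, sub_self]
    exact (hp.mp this).symm
  exact (hψ.contDiffWithinAt).congr_of_eventuallyEq heq (heq.self_of_nhdsWithin ⟨ht, hd⟩)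

theorem apply_zero {t : ℝ} (ht : 0 < t) : ζ (t, 0) = 0 := by
  have h0 : (0 : ℝ) ∈ Ico (0 : ℝ) 2 := by norm_num
  have h1 := H.relation ht h0
  rw [zero_mul] at h1
  exact (mul_eq_zero.mp h1).resolve_right (Real.sqrt_pos.mpr (H.quadQuot_pos ht h0)).ne'

/-- By the root relation, ζ/d is the quotient of √((3 - d)/6) and √A. Both tend to √(1/2), because
the film and the stationary profile have the same slope at the contact point. -/
theorem hasDerivWithinAt_zero {t : ℝ} (ht : 0 < t) :
    HasDerivWithinAt (fun d => ζ (t, d)) 1 (Ico 0 2) 0 := by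
  rw [hasDerivWithinAt_iff_tendsto_slope]
  have h0 : (0 : ℝ) ∈ Ico (0 : ℝ) 2 := by norm_num
  have hz := H.apply_zero ht
  have hc : Tendsto (fun d => ζ (t, d)) (𝓝[Ico 0 2] 0) (𝓝 0) := by
    have h1 : ContinuousWithinAt (fun d => ζ (t, d)) (Ico 0 2) 0 :=
      (H.cont (t, 0) ⟨ht, h0⟩).comp (f := fun d : ℝ => (t, d)) (by fun_prop)
        (fun d hd => ⟨ht, hd⟩)
    have := h1.tendsto
    rwa [hz] at this
  have hA : Tendsto (fun d => √(quadQuot V (t, ζ (t, d)))) (𝓝[Ico 0 2] 0) (𝓝 (√(1 / 2))) := by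
    have h1 := ((continuous_slice (contDiffOn_quadQuot H.smooth) ht).sqrt.tendsto 0).comp hc
    simp only [quadQuot_zero (H.slope t ht)] at h1
    exact h1
  have hB : Tendsto (fun d : ℝ => √((3 - d) / 6)) (𝓝[Ico 0 2] 0) (𝓝 (√(1 / 2))) := by
    have h1 : Continuous (fun d : ℝ => √((3 - d) / 6)) := by fun_prop
    have h2 := h1.tendsto 0
    norm_num at h2 ⊢
    exact h2.mono_left nhdsWithin_le_nhds
  have hq := hB.div hA (by positivity)
  rw [div_self (by positivity)] at hq
  refine (hq.mono_left (nhdsWithin_mono _ sdiff_subset)).congr' ?_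
  filter_upwards [self_mem_nhdsWithin] with d hd
  have hd0 : d ≠ 0 := hd.2
  have hr := H.relation ht hd.1
  have hp := Real.sqrt_pos.mpr (H.quadQuot_pos ht hd.1)
  rw [slope_def_field, hz, sub_zero, sub_zero]
  simp only [Pi.div_apply]
  field_simp
  linarith

end ContactData

/-! ### The mass function and conservation of mass -/

/-- The height extended by zero outside the wetted interval, and constantly to negative times. -/
def filmExt (u : ℝ → ℝ → ℝ) (lm lp : ℝ → ℝ) (p : ℝ × ℝ) : ℝ :=
  u (max p.1 0) (max (lm (max p.1 0)) (min p.2 (lp (max p.1 0))))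

/-- The mass to the left of `x` at time `t`. -/
def cumMass (u : ℝ → ℝ → ℝ) (lm lp : ℝ → ℝ) (t x : ℝ) : ℝ :=
  ∫ z in (lm (max t 0))..x, filmExt u lm lp (t, z)

/-- The point to the left of which there is mass `s`. -/
def massInv (u : ℝ → ℝ → ℝ) (lm lp : ℝ → ℝ) (t s : ℝ) : ℝ :=
  sInf {x : ℝ | x ∈ Icc (lm t) (lp t) ∧ ∫ z in (lm t)..x, u t z = s}

/-- The mass of the stationary profile to the left of `y`. -/
def steadyMass (y : ℝ) : ℝ := (2 + 3 * y - y ^ 3) / 6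

theorem integral_steady (y : ℝ) : (1 / 2) * ∫ s in (-1 : ℝ)..y, (1 - s ^ 2) = steadyMass y := by
  rw [intervalIntegral.integral_sub (by simp) (by simp)]
  simp [integral_pow, steadyMass]
  ring

theorem lagrangianMap_eq (u : ℝ → ℝ → ℝ) (lm lp : ℝ → ℝ) (t y : ℝ) :
    lagrangianMap u lm lp t y = massInv u lm lp t (steadyMass y) := by
  rw [lagrangianMap, massInv, integral_steady]

theorem hasDerivAt_steadyMass (y : ℝ) : HasDerivAt steadyMass ((1 - y ^ 2) / 2) y := by
  have := ((((hasDerivAt_id y).const_mul 3).const_add 2).sub ((hasDerivAt_id y).pow 3)).div_const 6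
  exact this.congr_deriv (by simp; ring)

theorem continuous_steadyMass : Continuous steadyMass := by unfold steadyMass; fun_prop

theorem steadyMass_mem_Icc {y : ℝ} (hy : y ∈ Icc (-1 : ℝ) 1) :
    steadyMass y ∈ Icc (0 : ℝ) (2 / 3) := by
  obtain ⟨h1, h2⟩ := hy
  unfold steadyMass
  constructor <;> nlinarith [mul_nonneg (sq_nonneg (1 + y)) (by linarith : 0 ≤ 2 - y),
    mul_nonneg (sq_nonneg (1 - y)) (by linarith : 0 ≤ 2 + y)]

theorem steadyMass_mem_Ioo {y : ℝ} (hy : y ∈ Ioo (-1 : ℝ) 1) :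
    steadyMass y ∈ Ioo (0 : ℝ) (2 / 3) := by
  obtain ⟨h1, h2⟩ := hy
  have a1 : 0 < 1 + y := by linarith
  have a2 : 0 < 1 - y := by linarith
  have a3 : 0 < 2 - y := by linarith
  have a4 : 0 < 2 + y := by linarith
  have b1 : 0 < (1 + y) ^ 2 * (2 - y) := by positivity
  have b2 : 0 < (1 - y) ^ 2 * (2 + y) := by positivity
  unfold steadyMass
  constructor <;> nlinarith

namespace IsGlobalSmoothSolution

variable {u : ℝ → ℝ → ℝ} {lm lp : ℝ → ℝ} (S : IsGlobalSmoothSolution u lm lp)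
include S

theorem u_continuousOn : ContinuousOn (fun p : ℝ × ℝ => u p.1 p.2) (closedRegion lm lp) := by
  have := S.initial.2 0 (by norm_num)
  simpa using this

theorem nonneg {t x : ℝ} (ht : 0 ≤ t) (hx : x ∈ Icc (lm t) (lp t)) : 0 ≤ u t x := by
  rcases hx.1.eq_or_lt with h | h
  · rw [← h, S.left_zero t ht]
  · rcases hx.2.eq_or_lt with h' | h'
    · rw [h', S.right_zero t ht]
    · exact (S.pos t ht x ⟨h, h'⟩).le

theorem clamp_mem {t : ℝ} (ht : 0 ≤ t) (x : ℝ) : max (lm t) (min x (lp t)) ∈ Icc (lm t) (lp t) :=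
  ⟨le_max_left _ _, max_le (S.lt t ht).le (min_le_right _ _)⟩

theorem continuous_lm : Continuous fun t => lm (max t 0) :=
  S.lm_continuous.comp_continuous (by fun_prop) fun t => le_max_right t 0

theorem continuous_lp : Continuous fun t => lp (max t 0) :=
  S.lp_continuous.comp_continuous (by fun_prop) fun t => le_max_right t 0

theorem continuous_filmExt : Continuous (filmExt u lm lp) := by
  have h1 := S.continuous_lm
  have h2 := S.continuous_lp
  refine S.u_continuousOn.comp_continuous (f := fun p : ℝ × ℝ =>
    (max p.1 0, max (lm (max p.1 0)) (min p.2 (lp (max p.1 0))))) ?_ ?_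
  · exact (by fun_prop : Continuous fun p : ℝ × ℝ => max p.1 0).prodMk
      ((h1.comp continuous_fst).max (continuous_snd.min (h2.comp continuous_fst)))
  · intro p
    exact ⟨le_max_right _ _, S.clamp_mem (le_max_right _ _) _⟩

theorem filmExt_nonneg (p : ℝ × ℝ) : 0 ≤ filmExt u lm lp p :=
  S.nonneg (le_max_right _ _) (S.clamp_mem (le_max_right _ _) _)

omit S in
theorem filmExt_eq {t x : ℝ} (ht : 0 ≤ t) (hx : x ∈ Icc (lm t) (lp t)) :
    filmExt u lm lp (t, x) = u t x := by
  simp only [filmExt, max_eq_left ht, min_eq_left hx.2, max_eq_right hx.1]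

theorem continuous_cumMass : Continuous fun p : ℝ × ℝ => cumMass u lm lp p.1 p.2 := by
  have hf : Continuous (Function.uncurry fun t z => filmExt u lm lp (t, z)) :=
    S.continuous_filmExt
  have h1 := intervalIntegral.continuous_parametric_primitive_of_continuous (μ := volume)
    (a₀ := 0) hf
  have h2 : Continuous fun t => ∫ z in 0..(lm (max t 0)), filmExt u lm lp (t, z) :=
    intervalIntegral.continuous_parametric_intervalIntegral_of_continuous hf S.continuous_lm
  have e : (fun p : ℝ × ℝ => cumMass u lm lp p.1 p.2) = fun p =>
      (∫ z in 0..p.2, filmExt u lm lp (p.1, z)) -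
        ∫ z in 0..(lm (max p.1 0)), filmExt u lm lp (p.1, z) := by
    funext p
    have c : Continuous fun z => filmExt u lm lp (p.1, z) := S.continuous_filmExt.comp (by fun_prop)
    rw [intervalIntegral.integral_interval_sub_left (c.intervalIntegrable _ _)
      (c.intervalIntegrable _ _)]
    rfl
  rw [e]
  exact h1.sub (h2.comp continuous_fst)

theorem hasDerivAt_cumMass (t x : ℝ) :
    HasDerivAt (cumMass u lm lp t) (filmExt u lm lp (t, x)) x := by
  have c : Continuous fun z => filmExt u lm lp (t, z) := S.continuous_filmExt.comp (by fun_prop)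
  exact intervalIntegral.integral_hasDerivAt_right (c.intervalIntegrable _ _)
    c.stronglyMeasurable.stronglyMeasurableAtFilter c.continuousAt

omit S in
theorem cumMass_eq {t x : ℝ} (ht : 0 ≤ t) (hx : x ∈ Icc (lm t) (lp t)) :
    cumMass u lm lp t x = ∫ z in (lm t)..x, u t z := by
  simp only [cumMass, max_eq_left ht]
  apply intervalIntegral.integral_congr
  intro z hz
  rw [uIcc_of_le hx.1] at hz
  exact filmExt_eq ht ⟨hz.1, hz.2.trans hx.2⟩

omit S in
theorem cumMass_left {t : ℝ} (ht : 0 ≤ t) : cumMass u lm lp t (lm t) = 0 := by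
  simp [cumMass, max_eq_left ht]

theorem monotone_cumMass (t : ℝ) : Monotone (cumMass u lm lp t) :=
  monotone_of_deriv_nonneg (fun x => (S.hasDerivAt_cumMass t x).differentiableAt) fun x => by
    rw [(S.hasDerivAt_cumMass t x).deriv]; exact S.filmExt_nonneg _

theorem strictMonoOn_cumMass {t : ℝ} (ht : 0 ≤ t) :
    StrictMonoOn (cumMass u lm lp t) (Icc (lm t) (lp t)) := by
  apply strictMonoOn_of_deriv_pos (convex_Icc _ _)
  · exact fun x _ => (S.hasDerivAt_cumMass t x).continuousAt.continuousWithinAt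
  · intro x hx
    rw [interior_Icc] at hx
    rw [(S.hasDerivAt_cumMass t x).deriv, filmExt_eq ht (Ioo_subset_Icc_self hx)]
    exact S.pos t ht x hx

/-- A smooth function on positive times that agrees with the height on the wetted region. -/
def U : ℝ × ℝ → ℝ := S.smooth.choose

theorem smooth_U : ContDiffOn ℝ ∞ S.U posTime := S.smooth.choose_spec.1

theorem eq_U {t x : ℝ} (ht : 0 < t) (hx : x ∈ Icc (lm t) (lp t)) : u t x = S.U (t, x) :=
  S.smooth.choose_spec.2 t ht x hx

theorem hasDerivAt_lm {t : ℝ} (ht : 0 < t) : HasDerivAt lm (deriv lm t) t :=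
  ((S.lm_smooth.differentiableOn (by simp)).differentiableAt (Ioi_mem_nhds ht)).hasDerivAt

theorem hasDerivAt_lp {t : ℝ} (ht : 0 < t) : HasDerivAt lp (deriv lp t) t :=
  ((S.lp_smooth.differentiableOn (by simp)).differentiableAt (Ioi_mem_nhds ht)).hasDerivAt

theorem iteratedDeriv_three {t x : ℝ} (ht : 0 < t) (hx : x ∈ Ioo (lm t) (lp t)) :
    iteratedDeriv 3 (u t) x = dX (dX (dX S.U)) (t, x) := by
  have h : u t =ᶠ[𝓝 x] fun z => S.U (t, z) := by
    filter_upwards [isOpen_Ioo.mem_nhds hx] with z hz using S.eq_U ht (Ioo_subset_Icc_self hz)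
  rw [h.iteratedDeriv_eq 3]
  have d0 : deriv (fun z => S.U (t, z)) = fun z => dX S.U (t, z) :=
    funext fun z => (hasDerivAt_dX S.smooth_U ht z).deriv
  have d1 : deriv (fun z => dX S.U (t, z)) = fun z => dX (dX S.U) (t, z) :=
    funext fun z => (hasDerivAt_dX (contDiffOn_dX S.smooth_U) ht z).deriv
  have d2 : deriv (fun z => dX (dX S.U) (t, z)) = fun z => dX (dX (dX S.U)) (t, z) :=
    funext fun z => (hasDerivAt_dX (contDiffOn_dX (contDiffOn_dX S.smooth_U)) ht z).deriv
  rw [iteratedDeriv_succ, iteratedDeriv_succ, iteratedDeriv_succ, iteratedDeriv_zero, d0, d1, d2]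

/-- The equation in divergence form for the smooth extension. -/
theorem hasDerivAt_flux {t x : ℝ} (ht : 0 < t) (hx : x ∈ Ioo (lm t) (lp t)) :
    HasDerivAt (fun z => S.U (t, z) * dX (dX (dX S.U)) (t, z)) (-dT S.U (t, x)) x := by
  have e1 : (fun s => u s x) =ᶠ[𝓝 t] fun s => S.U (s, x) := by
    have hl := (S.hasDerivAt_lm ht).continuousAt.eventually (gt_mem_nhds hx.1)
    have hr := (S.hasDerivAt_lp ht).continuousAt.eventually (lt_mem_nhds hx.2)
    filter_upwards [hl, hr, Ioi_mem_nhds ht] with s h1 h2 h3 using S.eq_U h3 ⟨h1.le, h2.le⟩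
  have e2 : (fun z => u t z * iteratedDeriv 3 (u t) z) =ᶠ[𝓝 x]
      fun z => S.U (t, z) * dX (dX (dX S.U)) (t, z) := by
    filter_upwards [isOpen_Ioo.mem_nhds hx] with z hz
    rw [S.eq_U ht (Ioo_subset_Icc_self hz), S.iteratedDeriv_three ht hz]
  have h := S.equation t ht x hx
  rw [e1.deriv_eq, e2.deriv_eq, (hasDerivAt_dT S.smooth_U ht x).deriv] at h
  have hd := (hasDerivAt_dX S.smooth_U ht x).mul
    (hasDerivAt_dX (contDiffOn_dX (contDiffOn_dX (contDiffOn_dX S.smooth_U))) ht x)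
  have h2 := hd.differentiableAt.hasDerivAt
  refine h2.congr_deriv ?_
  have h3 : deriv ((fun z => S.U (t, z)) * fun z => dX (dX (dX S.U)) (t, z)) x =
    deriv (fun z => S.U (t, z) * dX (dX (dX S.U)) (t, z)) x := rfl
  linarith

/-- The flux u u_xxx is continuous up to the left contact point and vanishes there with u, so
integrating the equation leaves only the flux at x. -/
theorem integral_dT {t x : ℝ} (ht : 0 < t) (hx : x ∈ Icc (lm t) (lp t)) :
    ∫ z in (lm t)..x, dT S.U (t, z) = -(S.U (t, x) * dX (dX (dX S.U)) (t, x)) := by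
  have c3 := contDiffOn_dX (contDiffOn_dX (contDiffOn_dX S.smooth_U))
  have h := intervalIntegral.integral_eq_sub_of_hasDerivAt_of_le hx.1
    (f := fun z => S.U (t, z) * dX (dX (dX S.U)) (t, z)) (f' := fun z => -dT S.U (t, z))
    (((continuous_slice S.smooth_U ht).mul (continuous_slice c3 ht)).continuousOn)
    (fun z hz => S.hasDerivAt_flux ht ⟨hz.1, hz.2.trans_le hx.2⟩)
    ((continuous_slice (contDiffOn_dT S.smooth_U) ht).neg.intervalIntegrable _ _)
  rw [intervalIntegral.integral_neg, ← S.eq_U ht (left_mem_Icc.mpr (S.lt t ht.le).le),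
    S.left_zero t ht.le, zero_mul, sub_zero] at h
  linarith

theorem cumMass_eq_integral_U {t x : ℝ} (ht : 0 < t) (hx : x ∈ Icc (lm t) (lp t)) :
    cumMass u lm lp t x = ∫ z in (lm t)..x, S.U (t, z) := by
  rw [cumMass_eq ht.le hx]
  apply intervalIntegral.integral_congr
  intro z hz
  rw [uIcc_of_le hx.1] at hz
  exact S.eq_U ht ⟨hz.1, hz.2.trans hx.2⟩

/-- Change of the mass to the left of a moving point of the wetted region. -/
theorem hasDerivAt_mass_moving {t b' : ℝ} {b : ℝ → ℝ} (ht : 0 < t)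
    (hb : HasDerivAt b b' t) (hbm : ∀ s, 0 < s → b s ∈ Icc (lm s) (lp s)) :
    HasDerivAt (fun s => cumMass u lm lp s (b s))
      (S.U (t, b t) * (b' - dX (dX (dX S.U)) (t, b t))) t := by
  have h := hasDerivAt_integral_moving S.smooth_U ht (S.hasDerivAt_lm ht) hb
  rw [S.integral_dT ht (hbm t ht), ← S.eq_U ht (left_mem_Icc.mpr (S.lt t ht.le).le),
    S.left_zero t ht.le] at h
  refine (h.congr_deriv (by ring)).congr_of_eventuallyEq ?_
  filter_upwards [Ioi_mem_nhds ht] with s hs using S.cumMass_eq_integral_U hs (hbm s hs)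

/-- Conservation of mass. -/
theorem mass_const {t : ℝ} (ht : 0 ≤ t) :
    cumMass u lm lp t (lp t) = cumMass u lm lp 0 (lp 0) := by
  rcases ht.eq_or_lt with h | h
  · rw [← h]
  have hd : ∀ s, 0 < s → HasDerivAt (fun s => cumMass u lm lp s (lp s)) 0 s := by
    intro s hs
    have h1 := S.hasDerivAt_mass_moving hs (S.hasDerivAt_lp hs)
      fun r hr => right_mem_Icc.mpr (S.lt r hr.le).le
    refine h1.congr_deriv ?_
    rw [← S.eq_U hs (right_mem_Icc.mpr (S.lt s hs.le).le), S.right_zero s hs.le, zero_mul]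
  have hc : ContinuousOn (fun s => cumMass u lm lp s (lp s)) (Icc 0 t) :=
    S.continuous_cumMass.comp_continuousOn
      (continuousOn_id.prodMk (S.lp_continuous.mono fun s hs => hs.1))
  -- The mean value theorem needs differentiability only for s > 0; joint continuity of the mass
  -- function includes the initial time.
  obtain ⟨c, hcm, hc'⟩ := exists_hasDerivAt_eq_slope _ (fun _ => 0) h hc
    fun s hs => hd s hs.1
  have : t - 0 ≠ 0 := by linarith
  field_simp at hc'
  linarith

end IsGlobalSmoothSolution

/-! ### The Lagrangian map and its regularity up to the boundary -/

/-- One-sided space derivative of the height on the wetted interval. -/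
def uX (u : ℝ → ℝ → ℝ) (lm lp : ℝ → ℝ) (t x : ℝ) : ℝ :=
  iteratedDerivWithin 1 (u t) (Icc (lm t) (lp t)) x

namespace IsGlobalSmoothSolution

variable {u : ℝ → ℝ → ℝ} {lm lp : ℝ → ℝ} (S : IsGlobalSmoothSolution u lm lp)
  (hM : ∫ x in (lm 0)..(lp 0), u 0 x = 2 / 3)
include S

theorem massInv_eq {t s x : ℝ} (ht : 0 ≤ t) (hx : x ∈ Icc (lm t) (lp t))
    (h : cumMass u lm lp t x = s) : massInv u lm lp t s = x := by
  have : {x : ℝ | x ∈ Icc (lm t) (lp t) ∧ ∫ z in (lm t)..x, u t z = s} = {x} := by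
    ext z
    simp only [mem_ofPred_eq, mem_singleton_iff]
    constructor
    · rintro ⟨hz, h'⟩
      rw [← cumMass_eq ht hz] at h'
      exact (S.strictMonoOn_cumMass ht).injOn hz hx (h'.trans h.symm)
    · rintro rfl
      exact ⟨hx, by rw [← cumMass_eq ht hx, h]⟩
  rw [massInv, this, csInf_singleton]

include hM

theorem mass_eq {t : ℝ} (ht : 0 ≤ t) : cumMass u lm lp t (lp t) = 2 / 3 := by
  rw [S.mass_const ht, cumMass_eq le_rfl (right_mem_Icc.mpr (S.lt 0 le_rfl).le), hM]

theorem massInv_spec {t s : ℝ} (ht : 0 ≤ t) (hs : s ∈ Icc (0 : ℝ) (2 / 3)) :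
    massInv u lm lp t s ∈ Icc (lm t) (lp t) ∧ cumMass u lm lp t (massInv u lm lp t s) = s := by
  have hc : ContinuousOn (cumMass u lm lp t) (Icc (lm t) (lp t)) :=
    fun x _ => (S.hasDerivAt_cumMass t x).continuousAt.continuousWithinAt
  have hs' : s ∈ Icc (cumMass u lm lp t (lm t)) (cumMass u lm lp t (lp t)) := by
    rwa [cumMass_left ht, S.mass_eq hM ht]
  obtain ⟨x, hx, hxs⟩ := intermediate_value_Icc (S.lt t ht).le hc hs'
  rw [S.massInv_eq ht hx hxs]
  exact ⟨hx, hxs⟩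

theorem massInv_mem_Ioo {t s : ℝ} (ht : 0 ≤ t) (hs : s ∈ Ioo (0 : ℝ) (2 / 3)) :
    massInv u lm lp t s ∈ Ioo (lm t) (lp t) := by
  obtain ⟨h1, h2⟩ := S.massInv_spec hM ht (Ioo_subset_Icc_self hs)
  refine ⟨h1.1.lt_of_ne fun h => ?_, h1.2.lt_of_ne fun h => ?_⟩
  · rw [← h, cumMass_left ht] at h2; exact hs.1.ne h2
  · rw [h, S.mass_eq hM ht] at h2; exact hs.2.ne' h2

/-- Inequalities between the inverse and a fixed a are inequalities between the mass to the left of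
a and s, which are stable by continuity of the mass function. If a lies outside the wetted interval,
continuity of the contact points is used instead. -/
theorem continuousOn_massInv :
    ContinuousOn (fun p : ℝ × ℝ => massInv u lm lp p.1 p.2) (Ici 0 ×ˢ Icc 0 (2 / 3)) := by
  rintro ⟨t₀, s₀⟩ ⟨ht₀, hs₀⟩
  simp only [mem_Ici] at ht₀
  simp only at hs₀
  obtain ⟨hx₀, hc₀⟩ := S.massInv_spec hM ht₀ hs₀
  set x₀ := massInv u lm lp t₀ s₀ with hx
  have hlm : Tendsto (fun p : ℝ × ℝ => lm p.1) (𝓝[Ici 0 ×ˢ Icc 0 (2 / 3)] (t₀, s₀)) (𝓝 (lm t₀)) :=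
    (S.lm_continuous t₀ ht₀).tendsto.comp (tendsto_nhdsWithin_of_tendsto_nhds_of_eventually_within _
      (continuous_fst.continuousWithinAt)
      (by filter_upwards [self_mem_nhdsWithin] with p hp using hp.1))
  have hlp : Tendsto (fun p : ℝ × ℝ => lp p.1) (𝓝[Ici 0 ×ˢ Icc 0 (2 / 3)] (t₀, s₀)) (𝓝 (lp t₀)) :=
    (S.lp_continuous t₀ ht₀).tendsto.comp (tendsto_nhdsWithin_of_tendsto_nhds_of_eventually_within _
      (continuous_fst.continuousWithinAt)
      (by filter_upwards [self_mem_nhdsWithin] with p hp using hp.1))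
  have hcm : ∀ a, Tendsto (fun p : ℝ × ℝ => cumMass u lm lp p.1 a - p.2)
      (𝓝[Ici 0 ×ˢ Icc 0 (2 / 3)] (t₀, s₀)) (𝓝 (cumMass u lm lp t₀ a - s₀)) := by
    intro a
    have : Continuous fun p : ℝ × ℝ => cumMass u lm lp p.1 a - p.2 :=
      (S.continuous_cumMass.comp (continuous_fst.prodMk continuous_const)).sub continuous_snd
    exact (this.tendsto (t₀, s₀)).mono_left nhdsWithin_le_nhds
  refine tendsto_order.mpr ⟨fun a ha => ?_, fun a ha => ?_⟩
  · change a < x₀ at ha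
    rcases lt_or_ge a (lm t₀) with h | h
    · filter_upwards [hlm.eventually (lt_mem_nhds h), self_mem_nhdsWithin] with p hp hpm
      exact hp.trans_le (S.massInv_spec hM hpm.1 hpm.2).1.1
    · have h1 : cumMass u lm lp t₀ a - s₀ < 0 := by
        have := S.strictMonoOn_cumMass ht₀ ⟨h, ha.le.trans hx₀.2⟩ hx₀ ha
        linarith
      filter_upwards [(hcm a).eventually (gt_mem_nhds h1), self_mem_nhdsWithin] with p hp hpm
      by_contra hcon
      have := S.monotone_cumMass p.1 (not_lt.mp hcon)
      rw [(S.massInv_spec hM hpm.1 hpm.2).2] at this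
      linarith
  · change x₀ < a at ha
    rcases lt_or_ge (lp t₀) a with h | h
    · filter_upwards [hlp.eventually (gt_mem_nhds h), self_mem_nhdsWithin] with p hp hpm
      exact (S.massInv_spec hM hpm.1 hpm.2).1.2.trans_lt hp
    · have h1 : 0 < cumMass u lm lp t₀ a - s₀ := by
        have := S.strictMonoOn_cumMass ht₀ hx₀ ⟨hx₀.1.trans ha.le, h⟩ ha
        linarith
      filter_upwards [(hcm a).eventually (lt_mem_nhds h1), self_mem_nhdsWithin] with p hp hpm
      by_contra hcon
      have := S.monotone_cumMass p.1 (not_lt.mp hcon)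
      rw [(S.massInv_spec hM hpm.1 hpm.2).2] at this
      linarith

theorem hasDerivAt_massInv {t s : ℝ} (ht : 0 ≤ t) (hs : s ∈ Ioo (0 : ℝ) (2 / 3)) :
    HasDerivAt (massInv u lm lp t) (u t (massInv u lm lp t s))⁻¹ s := by
  have hm := S.massInv_mem_Ioo hM ht hs
  have hpos := S.pos t ht _ hm
  have hcont : ContinuousAt (massInv u lm lp t) s := by
    have h1 : ContinuousWithinAt (massInv u lm lp t) (Icc 0 (2 / 3)) s :=
      (S.continuousOn_massInv hM (t, s) ⟨ht, Ioo_subset_Icc_self hs⟩).comp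
        (f := fun s : ℝ => (t, s)) (by fun_prop) (fun r hr => ⟨ht, hr⟩)
    exact h1.continuousAt (Icc_mem_nhds hs.1 hs.2)
  have hd := S.hasDerivAt_cumMass t (massInv u lm lp t s)
  rw [filmExt_eq ht (Ioo_subset_Icc_self hm)] at hd
  apply HasDerivAt.of_local_left_inverse hcont hd hpos.ne'
  filter_upwards [isOpen_Ioo.mem_nhds hs] with r hr
  exact (S.massInv_spec hM ht (Ioo_subset_Icc_self hr)).2

/-! The Lagrangian map. -/

theorem lagrangianMap_spec {t y : ℝ} (ht : 0 ≤ t) (hy : y ∈ Icc (-1 : ℝ) 1) :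
    lagrangianMap u lm lp t y ∈ Icc (lm t) (lp t) ∧
      cumMass u lm lp t (lagrangianMap u lm lp t y) = steadyMass y := by
  rw [lagrangianMap_eq]
  exact S.massInv_spec hM ht (steadyMass_mem_Icc hy)

theorem lagrangianMap_mem_Ioo {t y : ℝ} (ht : 0 ≤ t) (hy : y ∈ Ioo (-1 : ℝ) 1) :
    lagrangianMap u lm lp t y ∈ Ioo (lm t) (lp t) := by
  rw [lagrangianMap_eq]
  exact S.massInv_mem_Ioo hM ht (steadyMass_mem_Ioo hy)

theorem lagrangianHeight_pos {t y : ℝ} (ht : 0 ≤ t) (hy : y ∈ Ioo (-1 : ℝ) 1) :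
    0 < lagrangianHeight u lm lp t y :=
  S.pos t ht _ (S.lagrangianMap_mem_Ioo hM ht hy)

omit hM in
theorem lagrangianMap_left {t : ℝ} (ht : 0 ≤ t) : lagrangianMap u lm lp t (-1) = lm t := by
  rw [lagrangianMap_eq]
  apply S.massInv_eq ht (left_mem_Icc.mpr (S.lt t ht).le)
  rw [cumMass_left ht, steadyMass]; norm_num

theorem lagrangianMap_right {t : ℝ} (ht : 0 ≤ t) : lagrangianMap u lm lp t 1 = lp t := by
  rw [lagrangianMap_eq]
  apply S.massInv_eq ht (right_mem_Icc.mpr (S.lt t ht).le)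
  rw [S.mass_eq hM ht, steadyMass]; norm_num

theorem continuousOn_lagrangianMap :
    ContinuousOn (fun p : ℝ × ℝ => lagrangianMap u lm lp p.1 p.2) (Ici 0 ×ˢ Icc (-1) 1) := by
  simp_rw [lagrangianMap_eq]
  exact (S.continuousOn_massInv hM).comp (f := fun p : ℝ × ℝ => (p.1, steadyMass p.2))
    (continuous_fst.prodMk (continuous_steadyMass.comp continuous_snd)).continuousOn
    fun p hp => ⟨hp.1, steadyMass_mem_Icc hp.2⟩

theorem hasDerivAt_lagrangianMap {t y : ℝ} (ht : 0 ≤ t) (hy : y ∈ Ioo (-1 : ℝ) 1) :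
    HasDerivAt (lagrangianMap u lm lp t) ((1 - y ^ 2) / 2 / lagrangianHeight u lm lp t y) y := by
  have h := (S.hasDerivAt_massInv hM ht (steadyMass_mem_Ioo hy)).comp y (hasDerivAt_steadyMass y)
  have e : lagrangianMap u lm lp t = massInv u lm lp t ∘ steadyMass :=
    funext fun z => lagrangianMap_eq u lm lp t z
  rw [e]
  refine h.congr_deriv ?_
  rw [lagrangianHeight, lagrangianMap_eq]; ring

/-! Contact points. -/

omit hM

theorem contDiffOn_u {t : ℝ} (ht : 0 ≤ t) : ContDiffOn ℝ 2 (u t) (Icc (lm t) (lp t)) := by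
  rcases ht.eq_or_lt with h | h
  · rw [← h]; exact S.initial.1
  · have h1 : ContDiffOn ℝ ∞ (fun x => S.U (t, x)) (Icc (lm t) (lp t)) :=
      S.smooth_U.comp (f := fun x : ℝ => (t, x)) (ContDiff.contDiffOn (by fun_prop))
        fun x _ => mem_posTime h
    exact (h1.of_le (by norm_cast)).congr fun x hx => S.eq_U h hx

theorem hasDerivWithinAt_u {t x : ℝ} (ht : 0 ≤ t) (hx : x ∈ Icc (lm t) (lp t)) :
    HasDerivWithinAt (u t) (uX u lm lp t x) (Icc (lm t) (lp t)) x := by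
  rw [uX, iteratedDerivWithin_one]
  exact ((S.contDiffOn_u ht).differentiableOn (by norm_num) x hx).hasDerivWithinAt

/-- Positivity of the film selects the sign in the contact angle condition: difference quotients at
the left end are nonnegative. -/
theorem uX_left {t : ℝ} (ht : 0 ≤ t) : uX u lm lp t (lm t) = 1 := by
  have hlt := S.lt t ht
  have hd := S.hasDerivWithinAt_u ht (left_mem_Icc.mpr hlt.le)
  have ha := S.left_angle t ht
  rw [hd.derivWithin (uniqueDiffOn_Icc hlt _ (left_mem_Icc.mpr hlt.le))] at ha
  have hnn : 0 ≤ uX u lm lp t (lm t) := by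
    rw [hasDerivWithinAt_iff_tendsto_slope] at hd
    have hne : (𝓝[Icc (lm t) (lp t) \ {lm t}] (lm t)).NeBot := by
      rw [Icc_sdiff_left]; exact left_nhdsWithin_Ioc_neBot hlt
    refine ge_of_tendsto hd ?_
    filter_upwards [self_mem_nhdsWithin] with x hx
    rw [slope_def_field, S.left_zero t ht, sub_zero]
    exact div_nonneg (S.nonneg ht hx.1) (by linarith [hx.1.1])
  rwa [abs_of_nonneg hnn] at ha

theorem uX_right {t : ℝ} (ht : 0 ≤ t) : uX u lm lp t (lp t) = -1 := by
  have hlt := S.lt t ht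
  have hd := S.hasDerivWithinAt_u ht (right_mem_Icc.mpr hlt.le)
  have ha := S.right_angle t ht
  rw [hd.derivWithin (uniqueDiffOn_Icc hlt _ (right_mem_Icc.mpr hlt.le))] at ha
  have hnn : uX u lm lp t (lp t) ≤ 0 := by
    rw [hasDerivWithinAt_iff_tendsto_slope] at hd
    have hne : (𝓝[Icc (lm t) (lp t) \ {lp t}] (lp t)).NeBot := by
      rw [Icc_sdiff_right]; exact right_nhdsWithin_Ico_neBot hlt
    refine le_of_tendsto hd ?_
    filter_upwards [self_mem_nhdsWithin] with x hx
    rw [slope_def_field, S.right_zero t ht, sub_zero]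
    exact div_nonpos_of_nonneg_of_nonpos (S.nonneg ht hx.1) (by linarith [hx.1.2])
  rw [abs_of_nonpos hnn] at ha
  linarith

theorem dX_left {t : ℝ} (ht : 0 < t) : dX S.U (t, lm t) = 1 := by
  have hlt := S.lt t ht.le
  have hm := left_mem_Icc.mpr hlt.le
  have hd : HasDerivWithinAt (u t) (dX S.U (t, lm t)) (Icc (lm t) (lp t)) (lm t) :=
    (hasDerivAt_dX S.smooth_U ht _).hasDerivWithinAt.congr (fun x hx => S.eq_U ht hx)
      (S.eq_U ht hm)
  rw [← S.uX_left ht.le]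
  exact (uniqueDiffOn_Icc hlt _ hm).eq_deriv _ hd (S.hasDerivWithinAt_u ht.le hm)

theorem dX_right {t : ℝ} (ht : 0 < t) : dX S.U (t, lp t) = -1 := by
  have hlt := S.lt t ht.le
  have hm := right_mem_Icc.mpr hlt.le
  have hd : HasDerivWithinAt (u t) (dX S.U (t, lp t)) (Icc (lm t) (lp t)) (lp t) :=
    (hasDerivAt_dX S.smooth_U ht _).hasDerivWithinAt.congr (fun x hx => S.eq_U ht hx)
      (S.eq_U ht hm)
  rw [← S.uX_right ht.le]
  exact (uniqueDiffOn_Icc hlt _ hm).eq_deriv _ hd (S.hasDerivWithinAt_u ht.le hm)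

include hM

/-- The distances are ξ = x - λ₋ and d = 1 + y; in the latter the stationary mass is d²(3 - d)/6. -/
theorem contactData_left :
    ContactData (fun p => S.U (p.1, lm p.1 + p.2))
      (fun p => lagrangianMap u lm lp p.1 (p.2 - 1) - lm p.1) where
  smooth := by
    apply S.smooth_U.comp (f := fun p : ℝ × ℝ => (p.1, lm p.1 + p.2))
    · exact contDiffOn_fst.prodMk ((S.lm_smooth.comp contDiffOn_fst fun p hp => hp.1).add
        contDiffOn_snd)
    · exact fun p hp => ⟨hp.1, mem_univ _⟩
  zero t ht := by
    simp only [add_zero]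
    rw [← S.eq_U ht (left_mem_Icc.mpr (S.lt t ht.le).le), S.left_zero t ht.le]
  slope t ht := by
    have hs : ContDiffOn ℝ ∞ (fun p : ℝ × ℝ => S.U (p.1, lm p.1 + p.2)) posTime := by
      apply S.smooth_U.comp (f := fun p : ℝ × ℝ => (p.1, lm p.1 + p.2))
      · exact contDiffOn_fst.prodMk ((S.lm_smooth.comp contDiffOn_fst fun p hp => hp.1).add
          contDiffOn_snd)
      · exact fun p hp => ⟨hp.1, mem_univ _⟩
    have h1 := hasDerivAt_dX hs ht 0
    have h2 := (hasDerivAt_dX S.smooth_U ht (lm t + 0)).comp 0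
      ((hasDerivAt_id (0 : ℝ)).const_add (lm t))
    rw [h1.unique h2, mul_one, add_zero, S.dX_left ht]
  cont := by
    refine ContinuousOn.sub ?_ (S.lm_smooth.continuousOn.comp continuousOn_fst fun p hp => hp.1)
    exact (S.continuousOn_lagrangianMap hM).comp (f := fun p : ℝ × ℝ => (p.1, p.2 - 1))
      (by fun_prop) fun p hp => ⟨le_of_lt (mem_Ioi.mp hp.1), by
        have := hp.2.1; have := hp.2.2; constructor <;> simp only <;> linarith⟩
  nonneg t ht d hd := by
    have := (S.lagrangianMap_spec hM ht.le (y := d - 1) ⟨by linarith [hd.1],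
      by linarith [hd.2]⟩).1.1
    simp only; linarith
  pos t ht d hd s hs := by
    simp only [mem_Ioc] at hs
    have h1 : d - 1 < 1 := by linarith [hd.2]
    have hd0 : d ≠ 0 := by
      rintro rfl
      rw [zero_sub, S.lagrangianMap_left ht.le] at hs
      linarith [hs.1, hs.2]
    have h2 := S.lagrangianMap_mem_Ioo hM ht.le (y := d - 1)
      ⟨by have := hd.1.lt_of_ne' hd0; linarith, h1⟩
    have h3 : lm t + s ∈ Ioo (lm t) (lp t) := ⟨by linarith, by linarith [h2.2]⟩
    simp only
    rw [← S.eq_U ht (Ioo_subset_Icc_self h3)]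
    exact S.pos t ht.le _ h3
  mass t ht d hd := by
    obtain ⟨h1, h2⟩ := S.lagrangianMap_spec hM ht.le (y := d - 1) ⟨by linarith [hd.1],
      by linarith [hd.2]⟩
    simp only
    rw [intervalIntegral.integral_comp_add_left (fun x => S.U (t, x)), add_zero,
      add_sub_cancel, ← S.cumMass_eq_integral_U ht h1, h2, steadyMass]
    ring

/-- Reflection of the left contact point, with d = 1 - y. Mass is now counted from the right, so the
total mass 2/3 enters at every time. -/
theorem contactData_right :
    ContactData (fun p => S.U (p.1, lp p.1 - p.2))
      (fun p => lp p.1 - lagrangianMap u lm lp p.1 (1 - p.2)) where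
  smooth := by
    apply S.smooth_U.comp (f := fun p : ℝ × ℝ => (p.1, lp p.1 - p.2))
    · exact contDiffOn_fst.prodMk ((S.lp_smooth.comp contDiffOn_fst fun p hp => hp.1).sub
        contDiffOn_snd)
    · exact fun p hp => ⟨hp.1, mem_univ _⟩
  zero t ht := by
    simp only [sub_zero]
    rw [← S.eq_U ht (right_mem_Icc.mpr (S.lt t ht.le).le), S.right_zero t ht.le]
  slope t ht := by
    have hs : ContDiffOn ℝ ∞ (fun p : ℝ × ℝ => S.U (p.1, lp p.1 - p.2)) posTime := by
      apply S.smooth_U.comp (f := fun p : ℝ × ℝ => (p.1, lp p.1 - p.2))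
      · exact contDiffOn_fst.prodMk ((S.lp_smooth.comp contDiffOn_fst fun p hp => hp.1).sub
          contDiffOn_snd)
      · exact fun p hp => ⟨hp.1, mem_univ _⟩
    have h1 := hasDerivAt_dX hs ht 0
    have h2 := (hasDerivAt_dX S.smooth_U ht (lp t - 0)).comp 0
      ((hasDerivAt_id (0 : ℝ)).const_sub (lp t))
    rw [h1.unique h2, sub_zero, S.dX_right ht]; norm_num
  cont := by
    refine ContinuousOn.sub (S.lp_smooth.continuousOn.comp continuousOn_fst fun p hp => hp.1) ?_
    exact (S.continuousOn_lagrangianMap hM).comp (f := fun p : ℝ × ℝ => (p.1, 1 - p.2))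
      (by fun_prop) fun p hp => ⟨le_of_lt (mem_Ioi.mp hp.1), by
        have := hp.2.1; have := hp.2.2; constructor <;> simp only <;> linarith⟩
  nonneg t ht d hd := by
    have := (S.lagrangianMap_spec hM ht.le (y := 1 - d) ⟨by linarith [hd.2],
      by linarith [hd.1]⟩).1.2
    simp only; linarith
  pos t ht d hd s hs := by
    simp only [mem_Ioc] at hs
    have h1 : -1 < 1 - d := by linarith [hd.2]
    have hd0 : d ≠ 0 := by
      rintro rfl
      rw [sub_zero, S.lagrangianMap_right hM ht.le] at hs
      linarith [hs.1, hs.2]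
    have h2 := S.lagrangianMap_mem_Ioo hM ht.le (y := 1 - d)
      ⟨h1, by have := hd.1.lt_of_ne' hd0; linarith⟩
    have h3 : lp t - s ∈ Ioo (lm t) (lp t) := ⟨by linarith [h2.1], by linarith⟩
    simp only
    rw [← S.eq_U ht (Ioo_subset_Icc_self h3)]
    exact S.pos t ht.le _ h3
  mass t ht d hd := by
    obtain ⟨h1, h2⟩ := S.lagrangianMap_spec hM ht.le (y := 1 - d) ⟨by linarith [hd.2],
      by linarith [hd.1]⟩
    have h3 := S.mass_eq hM ht.le
    rw [S.cumMass_eq_integral_U ht (right_mem_Icc.mpr (S.lt t ht.le).le)] at h3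
    rw [S.cumMass_eq_integral_U ht h1] at h2
    have c := continuous_slice S.smooth_U ht
    simp only
    rw [intervalIntegral.integral_comp_sub_left (fun x => S.U (t, x)), sub_zero,
      sub_sub_cancel, ← intervalIntegral.integral_interval_sub_left (c.intervalIntegrable (lm t) _)
        (c.intervalIntegrable _ _), h3, h2, steadyMass]
    ring

/-- The Lagrangian map is smooth up to the boundary for positive times. -/
theorem contDiffOn_lagrangianMap :
    ContDiffOn ℝ ∞ (fun p : ℝ × ℝ => lagrangianMap u lm lp p.1 p.2) (Ioi 0 ×ˢ Icc (-1) 1) := by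
  have hl : ContDiffOn ℝ ∞ (fun p : ℝ × ℝ => lagrangianMap u lm lp p.1 p.2)
      (Ioi 0 ×ˢ Ico (-1) 1) := by
    have h1 := (S.contactData_left hM).contDiffOn.comp (s := Ioi (0 : ℝ) ×ˢ Ico (-1 : ℝ) 1)
      (f := fun p : ℝ × ℝ => (p.1, p.2 + 1)) (ContDiff.contDiffOn (by fun_prop))
      fun p hp => ⟨hp.1, by have := hp.2.1; have := hp.2.2; constructor <;> simp only <;> linarith⟩
    have h2 := h1.add (S.lm_smooth.comp contDiffOn_fst fun p hp => hp.1)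
    refine h2.congr fun p _ => ?_
    simp
  have hr : ContDiffOn ℝ ∞ (fun p : ℝ × ℝ => lagrangianMap u lm lp p.1 p.2)
      (Ioi 0 ×ˢ Ioc (-1) 1) := by
    have h1 := (S.contactData_right hM).contDiffOn.comp (s := Ioi (0 : ℝ) ×ˢ Ioc (-1 : ℝ) 1)
      (f := fun p : ℝ × ℝ => (p.1, 1 - p.2)) (ContDiff.contDiffOn (by fun_prop))
      fun p hp => ⟨hp.1, by have := hp.2.1; have := hp.2.2; constructor <;> simp only <;> linarith⟩
    have h2 := ContDiffOn.sub (S.lp_smooth.comp contDiffOn_fst fun p hp => hp.1) h1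
    refine h2.congr fun p _ => ?_
    simp
  rintro ⟨t, y⟩ ⟨ht, hy⟩
  simp only [mem_Ioi] at ht
  simp only at hy
  -- Each contact chart covers all of [-1, 1] except the opposite end, so the two charts suffice and
  -- no separate interior argument is needed.
  rcases lt_or_ge y 1 with h | h
  · refine (hl (t, y) ⟨ht, hy.1, h⟩).mono_of_mem_nhdsWithin ?_
    filter_upwards [self_mem_nhdsWithin, mem_nhdsWithin_of_mem_nhds
      ((isOpen_Iio.preimage continuous_snd).mem_nhds h)] with p hp hp'
    exact ⟨hp.1, hp.2.1, hp'⟩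
  · refine (hr (t, y) ⟨ht, by linarith, hy.2⟩).mono_of_mem_nhdsWithin ?_
    have h' : (-1 : ℝ) < y := by linarith
    filter_upwards [self_mem_nhdsWithin, mem_nhdsWithin_of_mem_nhds
      ((isOpen_Ioi.preimage continuous_snd).mem_nhds h')] with p hp hp'
    exact ⟨hp.1, hp', hp.2.2⟩

end IsGlobalSmoothSolution

/-! ### Calculus on the Lagrangian strip -/

/-- The space-time strip of the Lagrangian coordinates, at positive times. -/
def strip : Set (ℝ × ℝ) := Ioi 0 ×ˢ Icc (-1) 1

theorem uniqueDiffOn_strip : UniqueDiffOn ℝ strip :=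
  (isOpen_Ioi.uniqueDiffOn).prod (uniqueDiffOn_Icc (by norm_num))

/-- This allows symmetry of second derivatives within the strip to hold also at y = ±1. -/
theorem strip_subset_closure_interior : strip ⊆ closure (interior strip) := by
  rintro ⟨t, y⟩ ⟨ht, hy⟩
  rw [strip, interior_prod_eq, isOpen_Ioi.interior_eq, interior_Icc, closure_prod_eq,
    closure_Ioo (by norm_num)]
  exact ⟨subset_closure ht, hy⟩

/-- Time derivative within the strip. -/
def sT (f : ℝ × ℝ → ℝ) (p : ℝ × ℝ) : ℝ := fderivWithin ℝ f strip p (1, 0)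

/-- Space derivative within the strip. -/
def sY (f : ℝ × ℝ → ℝ) (p : ℝ × ℝ) : ℝ := fderivWithin ℝ f strip p (0, 1)

section

variable {f : ℝ × ℝ → ℝ} (hf : ContDiffOn ℝ ∞ f strip)
include hf

theorem contDiffOn_sT : ContDiffOn ℝ ∞ (sT f) strip :=
  (hf.fderivWithin uniqueDiffOn_strip (m := ∞) le_rfl).clm_apply contDiffOn_const

theorem contDiffOn_sY : ContDiffOn ℝ ∞ (sY f) strip :=
  (hf.fderivWithin uniqueDiffOn_strip (m := ∞) le_rfl).clm_apply contDiffOn_const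

theorem hasDerivAt_sT {t y : ℝ} (ht : 0 < t) (hy : y ∈ Icc (-1 : ℝ) 1) :
    HasDerivAt (fun s => f (s, y)) (sT f (t, y)) t := by
  have h1 : HasFDerivWithinAt f (fderivWithin ℝ f strip (t, y)) strip (t, y) :=
    (hf.differentiableOn (by simp) (t, y) ⟨ht, hy⟩).hasFDerivWithinAt
  have h2 : HasDerivWithinAt (fun s : ℝ => (s, y)) (1, 0) (Ioi 0) t :=
    ((hasDerivAt_id t).prodMk (hasDerivAt_const t y)).hasDerivWithinAt
  exact (h1.comp_hasDerivWithinAt t h2 (fun s hs => mk_mem_prod hs hy)).hasDerivAt (Ioi_mem_nhds ht)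

theorem hasDerivWithinAt_sY {t y : ℝ} (ht : 0 < t) (hy : y ∈ Icc (-1 : ℝ) 1) :
    HasDerivWithinAt (fun z => f (t, z)) (sY f (t, y)) (Icc (-1) 1) y := by
  have h1 : HasFDerivWithinAt f (fderivWithin ℝ f strip (t, y)) strip (t, y) :=
    (hf.differentiableOn (by simp) (t, y) ⟨ht, hy⟩).hasFDerivWithinAt
  have h2 : HasDerivWithinAt (fun z : ℝ => (t, z)) (0, 1) (Icc (-1) 1) y :=
    ((hasDerivAt_const y t).prodMk (hasDerivAt_id y)).hasDerivWithinAt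
  exact h1.comp_hasDerivWithinAt y h2 fun s hs => ⟨ht, hs⟩

theorem hasDerivAt_sY {t y : ℝ} (ht : 0 < t) (hy : y ∈ Ioo (-1 : ℝ) 1) :
    HasDerivAt (fun z => f (t, z)) (sY f (t, y)) y :=
  (hasDerivWithinAt_sY hf ht (Ioo_subset_Icc_self hy)).hasDerivAt (Icc_mem_nhds hy.1 hy.2)

theorem continuousOn_strip_slice {t : ℝ} (ht : 0 < t) :
    ContinuousOn (fun y => f (t, y)) (Icc (-1) 1) :=
  hf.continuousOn.comp (by fun_prop) fun _ hy => ⟨ht, hy⟩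

theorem sT_sY_comm {p : ℝ × ℝ} (hp : p ∈ strip) : sT (sY f) p = sY (sT f) p := by
  have hd : DifferentiableWithinAt ℝ (fderivWithin ℝ f strip) strip p :=
    (hf.fderivWithin uniqueDiffOn_strip (m := ∞) le_rfl).differentiableOn (by simp) p hp
  have happ : ∀ v : ℝ × ℝ, fderivWithin ℝ (fun q => fderivWithin ℝ f strip q v) strip p =
      (fderivWithin ℝ (fderivWithin ℝ f strip) strip p).flip v := by
    intro v
    have := hd.hasFDerivWithinAt.clm_apply (hasFDerivWithinAt_const v p strip)
    rw [this.fderivWithin (uniqueDiffOn_strip p hp)]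
    simp
  have hsymm : IsSymmSndFDerivWithinAt ℝ f strip p :=
    (hf p hp).isSymmSndFDerivWithinAt
      (by simp only [minSmoothness_of_isRCLikeNormedField]; norm_cast) uniqueDiffOn_strip
      (strip_subset_closure_interior hp) hp
  change fderivWithin ℝ (fun q => fderivWithin ℝ f strip q (0, 1)) strip p (1, 0) =
    fderivWithin ℝ (fun q => fderivWithin ℝ f strip q (1, 0)) strip p (0, 1)
  rw [happ, happ]
  exact hsymm _ _

/-- Differentiation under the integral sign on the strip. -/
theorem hasDerivAt_integral_strip {t : ℝ} (ht : 0 < t) :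
    HasDerivAt (fun s => ∫ y in (-1)..1, f (s, y)) (∫ y in (-1)..1, sT f (t, y)) t := by
  have hle : (-1 : ℝ) ≤ 1 := by norm_num
  have hsub : Icc (t / 2) (2 * t) ×ˢ Icc (-1 : ℝ) 1 ⊆ strip :=
    prod_mono (fun s hs => lt_of_lt_of_le (half_pos ht) hs.1) Subset.rfl
  obtain ⟨K, hK⟩ := (isCompact_Icc.prod isCompact_Icc).exists_bound_of_continuousOn
    ((contDiffOn_sT hf).continuousOn.mono hsub)
  have hI : ∀ {g : ℝ × ℝ → ℝ}, ContDiffOn ℝ ∞ g strip → ∀ s, 0 < s →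
      IntervalIntegrable (fun y => g (s, y)) volume (-1) 1 := by
    intro g hg s hs
    apply ContinuousOn.intervalIntegrable
    rw [uIcc_of_le hle]
    exact continuousOn_strip_slice hg hs
  have hmeas : ∀ {g : ℝ × ℝ → ℝ}, ContDiffOn ℝ ∞ g strip → ∀ s, 0 < s →
      AEStronglyMeasurable (fun y => g (s, y)) (volume.restrict (uIoc (-1) 1)) := by
    intro g hg s hs
    exact (intervalIntegrable_iff.mp (hI hg s hs)).aestronglyMeasurable
  refine (intervalIntegral.hasDerivAt_integral_of_dominated_loc_of_deriv_le
    (F := fun s y => f (s, y)) (F' := fun s y => sT f (s, y)) (bound := fun _ => K)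
    (s := Icc (t / 2) (2 * t)) (Icc_mem_nhds (by linarith) (by linarith)) ?_ (hI hf t ht)
    (hmeas (contDiffOn_sT hf) t ht) ?_ (by simp) ?_).2
  · filter_upwards [Ioi_mem_nhds ht] with s hs using hmeas hf s hs
  · refine Eventually.of_forall fun y hy s hs => hK (s, y) ⟨hs, ?_⟩
    rw [uIoc_of_le hle] at hy
    exact Ioc_subset_Icc_self hy
  · refine Eventually.of_forall fun y hy s hs => ?_
    rw [uIoc_of_le hle] at hy
    exact hasDerivAt_sT hf (lt_of_lt_of_le (half_pos ht) hs.1) (Ioc_subset_Icc_self hy)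

end

/-! ### The evolution equation in Lagrangian coordinates -/

/-- The Lagrangian map as a function of `(t, y)`. -/
def lagr (u : ℝ → ℝ → ℝ) (lm lp : ℝ → ℝ) (p : ℝ × ℝ) : ℝ := lagrangianMap u lm lp p.1 p.2

/-- The inverse of `∂_y Z`, which is the ratio of the height and the stationary profile. -/
def ratio (u : ℝ → ℝ → ℝ) (lm lp : ℝ → ℝ) (p : ℝ × ℝ) : ℝ := (sY (lagr u lm lp) p)⁻¹

namespace IsGlobalSmoothSolution

variable {u : ℝ → ℝ → ℝ} {lm lp : ℝ → ℝ} (S : IsGlobalSmoothSolution u lm lp)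
  (hM : ∫ x in (lm 0)..(lp 0), u 0 x = 2 / 3)
include S hM

theorem contDiffOn_lagr : ContDiffOn ℝ ∞ (lagr u lm lp) strip := S.contDiffOn_lagrangianMap hM

/-- This is the contact angle condition in Lagrangian form: the derivative of ζ at d = 0 is one. It
supplies the boundary value F = 1. -/
theorem sY_lagr_left {t : ℝ} (ht : 0 < t) : sY (lagr u lm lp) (t, -1) = 1 := by
  have h1 : HasDerivWithinAt (fun d => lagr u lm lp (t, d - 1)) (sY (lagr u lm lp) (t, -1))
      (Ico 0 2) 0 := by
    have a : HasDerivWithinAt (fun z => lagr u lm lp (t, z)) (sY (lagr u lm lp) (t, -1))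
        (Icc (-1) 1) ((0 : ℝ) - 1) := by
      rw [zero_sub]
      exact hasDerivWithinAt_sY (S.contDiffOn_lagr hM) ht (by norm_num)
    have hmaps : MapsTo (fun d : ℝ => d - 1) (Ico 0 2) (Icc (-1) 1) := fun d hd =>
      ⟨by linarith [hd.1], by linarith [hd.2]⟩
    have b := a.comp (0 : ℝ) ((hasDerivAt_id' (0 : ℝ)).sub_const 1).hasDerivWithinAt hmaps
    rwa [mul_one] at b
  have h2 := ((S.contactData_left hM).hasDerivWithinAt_zero ht).add_const (lm t)
  have h3 : HasDerivWithinAt (fun d => lagr u lm lp (t, d - 1)) 1 (Ico 0 2) 0 :=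
    h2.congr (fun d _ => by simp [lagr]) (by simp [lagr])
  have hu : UniqueDiffWithinAt ℝ (Ico (0 : ℝ) 2) 0 := uniqueDiffOn_Ico 0 2 0 (by norm_num)
  rw [← h1.derivWithin hu, h3.derivWithin hu]

theorem sY_lagr_right {t : ℝ} (ht : 0 < t) : sY (lagr u lm lp) (t, 1) = 1 := by
  have h1 : HasDerivWithinAt (fun d => lagr u lm lp (t, 1 - d)) (-sY (lagr u lm lp) (t, 1))
      (Ico 0 2) 0 := by
    have a : HasDerivWithinAt (fun z => lagr u lm lp (t, z)) (sY (lagr u lm lp) (t, 1))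
        (Icc (-1) 1) ((1 : ℝ) - 0) := by
      rw [sub_zero]
      exact hasDerivWithinAt_sY (S.contDiffOn_lagr hM) ht (by norm_num)
    have hmaps : MapsTo (fun d : ℝ => 1 - d) (Ico 0 2) (Icc (-1) 1) := fun d hd =>
      ⟨by linarith [hd.2], by linarith [hd.1]⟩
    have b := a.comp (0 : ℝ) ((hasDerivAt_id' (0 : ℝ)).const_sub 1).hasDerivWithinAt hmaps
    rwa [mul_neg_one] at b
  have h2 := ((S.contactData_right hM).hasDerivWithinAt_zero ht).const_sub (lp t)
  have h3 : HasDerivWithinAt (fun d => lagr u lm lp (t, 1 - d)) (-1) (Ico 0 2) 0 :=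
    h2.congr (fun d _ => by simp [lagr]) (by simp [lagr])
  have hu : UniqueDiffWithinAt ℝ (Ico (0 : ℝ) 2) 0 := uniqueDiffOn_Ico 0 2 0 (by norm_num)
  rw [← neg_inj, ← h1.derivWithin hu, h3.derivWithin hu]

theorem sY_lagr {t y : ℝ} (ht : 0 < t) (hy : y ∈ Ioo (-1 : ℝ) 1) :
    sY (lagr u lm lp) (t, y) = (1 - y ^ 2) / 2 / lagrangianHeight u lm lp t y :=
  (hasDerivAt_sY (S.contDiffOn_lagr hM) ht hy).unique (S.hasDerivAt_lagrangianMap hM ht.le hy)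

theorem sY_lagr_pos {p : ℝ × ℝ} (hp : p ∈ strip) : 0 < sY (lagr u lm lp) p := by
  obtain ⟨t, y⟩ := p
  obtain ⟨ht, hy⟩ := hp
  simp only [mem_Ioi] at ht
  simp only at hy
  rcases hy.1.eq_or_lt with h | h
  · rw [← h, S.sY_lagr_left hM ht]; norm_num
  · rcases hy.2.eq_or_lt with h' | h'
    · rw [h', S.sY_lagr_right hM ht]; norm_num
    · rw [S.sY_lagr hM ht ⟨h, h'⟩]
      refine div_pos ?_ (S.lagrangianHeight_pos hM ht.le ⟨h, h'⟩)
      nlinarith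

theorem contDiffOn_ratio : ContDiffOn ℝ ∞ (ratio u lm lp) strip :=
  (contDiffOn_sY (S.contDiffOn_lagr hM)).inv fun _ hp => (S.sY_lagr_pos hM hp).ne'

theorem ratio_left {t : ℝ} (ht : 0 < t) : ratio u lm lp (t, -1) = 1 := by
  rw [ratio, S.sY_lagr_left hM ht, inv_one]

theorem ratio_right {t : ℝ} (ht : 0 < t) : ratio u lm lp (t, 1) = 1 := by
  rw [ratio, S.sY_lagr_right hM ht, inv_one]

theorem height_eq {t y : ℝ} (ht : 0 < t) (hy : y ∈ Ioo (-1 : ℝ) 1) :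
    S.U (t, lagr u lm lp (t, y)) = (1 - y ^ 2) / 2 * ratio u lm lp (t, y) := by
  have h1 := S.lagrangianHeight_pos hM ht.le hy
  have h2 : 0 < 1 - y ^ 2 := by nlinarith [hy.1, hy.2]
  have h3 := S.eq_U ht (S.lagrangianMap_spec hM ht.le (Ioo_subset_Icc_self hy)).1
  change lagrangianHeight u lm lp t y = S.U (t, lagr u lm lp (t, y)) at h3
  rw [ratio, S.sY_lagr hM ht hy, ← h3]
  field_simp

/-- The mass to the left of Z(t, y) is constant in time, while its derivative is u (Z_t - u_xxx).
Since u > 0 at interior points, the bracket vanishes. -/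
theorem sT_lagr {t y : ℝ} (ht : 0 < t) (hy : y ∈ Ioo (-1 : ℝ) 1) :
    sT (lagr u lm lp) (t, y) = dX (dX (dX S.U)) (t, lagr u lm lp (t, y)) := by
  have hyI := Ioo_subset_Icc_self hy
  have h1 := S.hasDerivAt_mass_moving ht (hasDerivAt_sT (S.contDiffOn_lagr hM) ht hyI)
    fun s hs => (S.lagrangianMap_spec hM hs.le hyI).1
  have h2 : HasDerivAt (fun s => cumMass u lm lp s (lagr u lm lp (s, y))) 0 t := by
    refine (hasDerivAt_const t (steadyMass y)).congr_of_eventuallyEq ?_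
    filter_upwards [Ioi_mem_nhds ht] with s hs
      using (S.lagrangianMap_spec hM (le_of_lt hs) hyI).2
  have h3 := h1.unique h2
  have h4 : 0 < S.U (t, lagr u lm lp (t, y)) := by
    have h5 := S.eq_U ht (S.lagrangianMap_spec hM ht.le hyI).1
    change lagrangianHeight u lm lp t y = S.U (t, lagr u lm lp (t, y)) at h5
    rw [← h5]
    exact S.lagrangianHeight_pos hM ht.le hy
  have := (mul_eq_zero.mp h3).resolve_left h4.ne'
  linarith

/-- Along the flow u = wF and ∂_x acts as F∂_y, so u_xxx is obtained by applying F∂_y three times to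
wF. -/
theorem sT_lagr_eq_velocityExpr {t y : ℝ} (ht : 0 < t) (hy : y ∈ Ioo (-1 : ℝ) 1) :
    sT (lagr u lm lp) (t, y) = velocityExpr y (ratio u lm lp (t, y)) (sY (ratio u lm lp) (t, y))
      (sY (sY (ratio u lm lp)) (t, y)) (sY (sY (sY (ratio u lm lp))) (t, y)) := by
  rw [S.sT_lagr hM ht hy]
  have s0 := S.contDiffOn_ratio hM
  have s1 := contDiffOn_sY s0
  have s2 := contDiffOn_sY s1
  -- transfer of a derivative in `x` to Lagrangian coordinates
  have step : ∀ {V : ℝ × ℝ → ℝ} {g : ℝ → ℝ} {g' : ℝ} {y : ℝ}, ContDiffOn ℝ ∞ V posTime →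
      (∀ z ∈ Ioo (-1 : ℝ) 1, V (t, lagr u lm lp (t, z)) = g z) → y ∈ Ioo (-1 : ℝ) 1 →
      HasDerivAt g g' y → dX V (t, lagr u lm lp (t, y)) = ratio u lm lp (t, y) * g' := by
    intro V g g' y hV hg hy hd
    have h1 := (hasDerivAt_dX hV ht (lagr u lm lp (t, y))).comp y
      (hasDerivAt_sY (S.contDiffOn_lagr hM) ht hy)
    have h2 : HasDerivAt ((fun x => V (t, x)) ∘ fun z => lagr u lm lp (t, z)) g' y := by
      refine hd.congr_of_eventuallyEq ?_
      filter_upwards [isOpen_Ioo.mem_nhds hy] with z hz using hg z hz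
    have h3 := h1.unique h2
    have h4 := S.sY_lagr_pos hM (p := (t, y)) ⟨ht, Ioo_subset_Icc_self hy⟩
    rw [ratio, ← h3]
    field_simp
  have dw : ∀ y : ℝ, HasDerivAt (fun y : ℝ => (1 - y ^ 2) / 2) (-y) y := by
    intro y
    exact ((((hasDerivAt_id y).pow 2).const_sub 1).div_const 2).congr_deriv (by simp; ring)
  have e1 : ∀ z ∈ Ioo (-1 : ℝ) 1, dX S.U (t, lagr u lm lp (t, z)) =
      ratio u lm lp (t, z) * (-z * ratio u lm lp (t, z) +
        (1 - z ^ 2) / 2 * sY (ratio u lm lp) (t, z)) := fun z hz =>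
    step S.smooth_U (fun z hz => S.height_eq hM ht hz) hz ((dw z).mul (hasDerivAt_sY s0 ht hz))
  have d2 : ∀ z ∈ Ioo (-1 : ℝ) 1, HasDerivAt (fun z => ratio u lm lp (t, z) *
      (-z * ratio u lm lp (t, z) + (1 - z ^ 2) / 2 * sY (ratio u lm lp) (t, z)))
      (sY (ratio u lm lp) (t, z) * (-z * ratio u lm lp (t, z) +
        (1 - z ^ 2) / 2 * sY (ratio u lm lp) (t, z)) + ratio u lm lp (t, z) *
        (-ratio u lm lp (t, z) - 2 * z * sY (ratio u lm lp) (t, z) +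
        (1 - z ^ 2) / 2 * sY (sY (ratio u lm lp)) (t, z))) z := by
    intro z hz
    have a0 := hasDerivAt_sY s0 ht hz
    have a1 := hasDerivAt_sY s1 ht hz
    exact (a0.mul (((hasDerivAt_id' z).neg.mul a0).add ((dw z).mul a1))).congr_deriv
      (by simp only [Pi.add_apply, Pi.mul_apply, Pi.neg_apply]; ring)
  have e2 : ∀ z ∈ Ioo (-1 : ℝ) 1, _ := fun z hz => step (contDiffOn_dX S.smooth_U) e1 hz (d2 z hz)
  have d3 := fun z (hz : z ∈ Ioo (-1 : ℝ) 1) => by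
    have a0 := hasDerivAt_sY s0 ht hz
    have a1 := hasDerivAt_sY s1 ht hz
    have a2 := hasDerivAt_sY s2 ht hz
    have az := hasDerivAt_id' z
    exact a0.mul ((a1.mul ((az.neg.mul a0).add ((dw z).mul a1))).add
      (a0.mul ((a0.neg.sub ((az.const_mul 2).mul a1)).add ((dw z).mul a2))))
  have e3 := step (contDiffOn_dX (contDiffOn_dX S.smooth_U)) e2 hy (d3 y hy)
  rw [e3, velocityExpr]
  simp only [Pi.add_apply, Pi.mul_apply, Pi.neg_apply, Pi.sub_apply]
  ring

/-- Differentiate F = 1/Z_y in time and exchange the two derivatives of Z. -/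
theorem sT_ratio {p : ℝ × ℝ} (hp : p ∈ strip) :
    sT (ratio u lm lp) p = -(ratio u lm lp p ^ 2 * sY (sT (lagr u lm lp)) p) := by
  obtain ⟨t, y⟩ := p
  have h1 := hasDerivAt_sT (S.contDiffOn_ratio hM) hp.1 hp.2
  have h2 := (hasDerivAt_sT (contDiffOn_sY (S.contDiffOn_lagr hM)) hp.1 hp.2).inv
    (S.sY_lagr_pos hM hp).ne'
  have h3 := h1.unique h2
  rw [h3, sT_sY_comm (S.contDiffOn_lagr hM) hp, ratio, inv_pow]
  ring

theorem sT_ratio_boundary {t y : ℝ} (ht : 0 < t) (hy : y ∈ Icc (-1 : ℝ) 1)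
    (h : ∀ s, 0 < s → ratio u lm lp (s, y) = 1) : sT (ratio u lm lp) (t, y) = 0 := by
  have h1 := hasDerivAt_sT (S.contDiffOn_ratio hM) ht hy
  refine h1.unique ((hasDerivAt_const t 1).congr_of_eventuallyEq ?_)
  filter_upwards [Ioi_mem_nhds ht] with s hs using h s hs

/-! ### Exponential decay from a positive time -/

/-- Twice the energy is differentiable in time, and decreases at an exponential rate while small. -/
theorem hasDerivAt_dirichlet {t : ℝ} (ht : 0 < t) :
    ∃ e' : ℝ, HasDerivAt (fun s => ∫ y in (-1)..1, sY (ratio u lm lp) (s, y) ^ 2) e' t ∧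
      (∫ y in (-1)..1, sY (ratio u lm lp) (t, y) ^ 2 ≤ (1 / 1000) ^ 2 →
        e' ≤ -(1 / 8) * ∫ y in (-1)..1, sY (ratio u lm lp) (t, y) ^ 2) := by
  have s0 := S.contDiffOn_ratio hM
  have s1 := contDiffOn_sY s0
  have s2 := contDiffOn_sY s1
  have s3 := contDiffOn_sY s2
  have z0 := S.contDiffOn_lagr hM
  have hml : (-1 : ℝ) ∈ Icc (-1 : ℝ) 1 := by norm_num
  have hmr : (1 : ℝ) ∈ Icc (-1 : ℝ) 1 := by norm_num
  refine ⟨_, hasDerivAt_integral_strip (s1.pow 2) ht, fun hsmall => ?_⟩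
  have e : ∫ y in (-1)..1, sT (fun p => sY (ratio u lm lp) p ^ 2) (t, y) =
      2 * ∫ y in (-1)..1, sY (ratio u lm lp) (t, y) * sY (sT (ratio u lm lp)) (t, y) := by
    rw [← intervalIntegral.integral_const_mul]
    apply intervalIntegral.integral_congr
    intro y hy
    rw [uIcc_of_le (by norm_num)] at hy
    have h1 := hasDerivAt_sT (s1.pow 2) ht hy
    have h2 := (hasDerivAt_sT s1 ht hy).pow 2
    have h3 := h1.unique h2
    simp only
    rw [h3, sT_sY_comm s0 (p := (t, y)) ⟨ht, hy⟩]
    push_cast; ring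
  rw [e]
  have key := energy_dissipation (continuousOn_strip_slice s0 ht) (continuousOn_strip_slice s1 ht)
    (continuousOn_strip_slice s2 ht) (continuousOn_strip_slice s3 ht)
    (fun y hy => hasDerivAt_sY s0 ht hy) (fun y hy => hasDerivAt_sY s1 ht hy)
    (fun y hy => hasDerivAt_sY s2 ht hy) (fun y hy => S.sT_lagr_eq_velocityExpr hM ht hy)
    (fun y hy => hasDerivAt_sY (contDiffOn_sT z0) ht hy)
    (continuousOn_strip_slice (contDiffOn_sT s0) ht)
    (continuousOn_strip_slice (contDiffOn_sY (contDiffOn_sT s0)) ht)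
    (fun y hy => hasDerivAt_sY (contDiffOn_sT s0) ht hy)
    (fun y hy => S.sT_ratio hM (p := (t, y)) ⟨ht, Ioo_subset_Icc_self hy⟩)
    (S.sT_ratio_boundary hM ht hml fun s hs => S.ratio_left hM hs)
    (S.sT_ratio_boundary hM ht hmr fun s hs => S.ratio_right hM hs)
    (S.ratio_left hM ht) (S.ratio_right hM ht) hsmall
  linarith

/-- Exponential decay from any positive time at which the energy is small. -/
theorem dirichlet_decay {s t : ℝ} (hs : 0 < s) (hst : s ≤ t)
    (hsmall : ∫ y in (-1)..1, sY (ratio u lm lp) (s, y) ^ 2 < (1 / 1000) ^ 2) :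
    ∫ y in (-1)..1, sY (ratio u lm lp) (t, y) ^ 2 ≤
      (∫ y in (-1)..1, sY (ratio u lm lp) (s, y) ^ 2) * Real.exp (-(1 / 16) * (t - s)) := by
  choose! e' he' hle using fun t (ht : 0 < t) => S.hasDerivAt_dirichlet hM ht
  set Q : ℝ → ℝ := fun r => ∫ y in (-1)..1, sY (ratio u lm lp) (r, y) ^ 2
  have hQ0 : 0 ≤ Q s := intervalIntegral.integral_nonneg (by norm_num) fun _ _ => sq_nonneg _
  change Q t ≤ Q s * _
  change Q s < _ at hsmall
  -- Comparison with b e^{-(r-s)/16}. At a first contact the true slope is at most -b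
  -- e^{-(r-s)/16}/8, strictly below that of the barrier. The inequality b > Q(s) ensures b > 0 even
  -- if Q(s) = 0, and b < 10⁻⁶ keeps the smallness hypothesis valid at a contact. Letting b tend to
  -- Q(s) concludes.
  have main : ∀ b, Q s < b → b < (1 / 1000) ^ 2 →
      Q t ≤ b * Real.exp (-(1 / 16) * (t - s)) := by
    intro b hb hb'
    have hb0 : 0 < b := hQ0.trans_lt hb
    have hB : ∀ r, HasDerivAt (fun r => b * Real.exp (-(1 / 16) * (r - s)))
        (-(1 / 16) * (b * Real.exp (-(1 / 16) * (r - s)))) r := by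
      intro r
      exact (((((hasDerivAt_id r).sub_const s).const_mul (-(1 / 16))).exp).const_mul b).congr_deriv
        (by simp only [id]; ring)
    refine image_le_of_deriv_right_lt_deriv_boundary' (f := Q) (f' := e') (a := s) (b := t)
      (B := fun r => b * Real.exp (-(1 / 16) * (r - s)))
      (B' := fun r => -(1 / 16) * (b * Real.exp (-(1 / 16) * (r - s)))) ?_ ?_ ?_ ?_ ?_ ?_
      ⟨hst, le_rfl⟩
    · exact fun r hr => (he' r (hs.trans_le hr.1)).continuousAt.continuousWithinAt
    · exact fun r hr => (he' r (hs.trans_le hr.1)).hasDerivWithinAt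
    · simp only [sub_self, mul_zero, Real.exp_zero, mul_one]; exact hb.le
    · exact fun r _ => (hB r).continuousAt.continuousWithinAt
    · exact fun r _ => (hB r).hasDerivWithinAt
    · intro r hr heq
      have hexp : Real.exp (-(1 / 16) * (r - s)) ≤ 1 := by
        rw [Real.exp_le_one_iff]; linarith [hr.1]
      have hpos : 0 < b * Real.exp (-(1 / 16) * (r - s)) := by positivity
      have h1 : Q r ≤ (1 / 1000) ^ 2 := by
        rw [heq]; nlinarith
      have h2 := hle r (hs.trans_le hr.1) h1
      change e' r ≤ -(1 / 8) * Q r at h2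
      rw [heq] at h2
      linarith
  have hlim : Tendsto (fun b => b * Real.exp (-(1 / 16) * (t - s))) (𝓝[>] (Q s))
      (𝓝 (Q s * Real.exp (-(1 / 16) * (t - s)))) :=
    ((continuous_id.mul continuous_const).tendsto (Q s)).mono_left nhdsWithin_le_nhds
  refine ge_of_tendsto hlim ?_
  filter_upwards [self_mem_nhdsWithin, mem_nhdsWithin_of_mem_nhds (Iio_mem_nhds hsmall)]
    with b h1 h2 using main b h1 h2

end IsGlobalSmoothSolution

/-! ### Bounds uniform up to the initial time -/

/-- Bound for `∂_y (ũ / u^∞)` near a contact point: `ξ` is the distance to the contact point in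
physical coordinates, `d` the one in Lagrangian coordinates, `h` the height, `p` its slope and `m`
the mass between the contact point and the given point. -/
theorem contact_estimate {ξ d h p m K : ℝ} (hξ : 0 < ξ) (hK : 1 ≤ K) (hKξ : K * ξ ≤ 1 / 10)
    (hp : |p - 1| ≤ K * ξ) (hh : |h - ξ| ≤ K * ξ ^ 2) (hm : |m - ξ ^ 2 / 2| ≤ K * ξ ^ 3)
    (hmd : m = d ^ 2 * (3 - d) / 6) (hd0 : 0 < d) (hd2 : d < 2) :
    |p / h + (d - 1) * h / (d * (2 - d) / 2) ^ 2| ≤ 20 * K := by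
  have hξ1 : ξ ≤ 1 / 10 := (le_mul_of_one_le_left hξ.le hK).trans hKξ
  have hξ2 : 0 < ξ ^ 2 := by positivity
  have hξ3 : 0 < ξ ^ 3 := by positivity
  obtain ⟨hp1, hp2⟩ := abs_le.mp hp
  obtain ⟨hh1, hh2⟩ := abs_le.mp hh
  obtain ⟨hm1, hm2⟩ := abs_le.mp hm
  have a1 : K * ξ ^ 2 ≤ 1 / 10 * ξ := by
    have := mul_le_mul_of_nonneg_right hKξ hξ.le
    linarith
  have a2 : K * ξ ^ 3 ≤ 1 / 10 * ξ ^ 2 := by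
    have := mul_le_mul_of_nonneg_right hKξ hξ2.le
    linarith
  have hl : 9 / 10 * ξ ≤ h := by linarith
  have hu : h ≤ 11 / 10 * ξ := by linarith
  have m1 : 4 / 10 * ξ ^ 2 ≤ m := by linarith
  have m2 : m ≤ 6 / 10 * ξ ^ 2 := by linarith
  have hd3 : 0 < d ^ 2 := by positivity
  have m3 : d ^ 2 / 6 ≤ m := by
    have := mul_le_mul_of_nonneg_left hd2.le hd3.le
    linarith
  have d1 : d ≤ 1 / 5 := by
    refine (le_abs_self d).trans (abs_le_of_sq_le_sq ?_ (by norm_num))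
    have := pow_le_pow_left₀ hξ.le hξ1 2
    linarith
  have m4 : 46 / 100 * d ^ 2 ≤ m := by
    have := mul_le_mul_of_nonneg_left d1 hd3.le
    linarith
  have m5 : m ≤ d ^ 2 / 2 := by
    have := mul_pos hd3 hd0
    linarith
  have d2 : d ≤ 12 / 10 * ξ := by
    refine (le_abs_self d).trans (abs_le_of_sq_le_sq ?_ (by linarith))
    rw [mul_pow]
    linarith
  have d3 : 8 / 10 * ξ ^ 2 ≤ d ^ 2 := by linarith
  obtain ⟨w, hw⟩ : ∃ w, w = d * (2 - d) / 2 := ⟨_, rfl⟩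
  rw [← hw]
  have w1 : 9 / 10 * d ≤ w := by
    have := mul_le_mul_of_nonneg_left d1 hd0.le
    rw [hw]; linarith
  have w2 : w ≤ d := by rw [hw]; linarith
  have w0 : 0 < w := by linarith
  have h0 : 0 < h := by linarith
  have wsq1 : 81 / 100 * d ^ 2 ≤ w ^ 2 := by
    have := pow_le_pow_left₀ (by positivity) w1 2
    rw [mul_pow] at this
    linarith
  have wsq2 : w ^ 2 ≤ d ^ 2 := pow_le_pow_left₀ w0.le w2 2
  have dsq : d ^ 2 ≤ 144 / 100 * ξ ^ 2 := by
    have := pow_le_pow_left₀ hd0.le d2 2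
    rw [mul_pow] at this
    linarith
  have den : 58 / 100 * ξ ^ 3 ≤ h * w ^ 2 := by
    have b3 : 648 / 1000 * ξ ^ 2 ≤ w ^ 2 := by linarith
    have b4 : (9 / 10 * ξ) * (648 / 1000 * ξ ^ 2) ≤ h * w ^ 2 :=
      mul_le_mul hl b3 (by positivity) h0.le
    linarith
  have den0 : 0 < h * w ^ 2 := by positivity
  -- Each summand is singular like 1/ξ. Over the common denominator, which is of order ξ³, the
  -- leading parts of the numerator cancel because w², 2m, ξ² and h² agree up to cubic errors.
  have e : p / h + (d - 1) * h / w ^ 2 = (p * w ^ 2 + (d - 1) * h ^ 2) / (h * w ^ 2) := by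
    field_simp
  rw [e, abs_div, abs_of_pos den0, div_le_iff₀ den0]
  have Kξ3 : 0 < K * ξ ^ 3 := by positivity
  have n1 : |(p - 1) * w ^ 2| ≤ 144 / 100 * (K * ξ ^ 3) := by
    rw [abs_mul, abs_of_nonneg (sq_nonneg w)]
    have := mul_le_mul hp (wsq2.trans dsq) (sq_nonneg w) (by positivity)
    linarith
  have n2 : |h ^ 2 - ξ ^ 2| ≤ 21 / 10 * (K * ξ ^ 3) := by
    have : h ^ 2 - ξ ^ 2 = (h - ξ) * (h + ξ) := by ring
    rw [this, abs_mul, abs_of_pos (by linarith : 0 < h + ξ)]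
    have := mul_le_mul hh (by linarith : h + ξ ≤ 21 / 10 * ξ) (by linarith) (by positivity)
    linarith
  have dcube : d ^ 3 ≤ 18 / 10 * ξ ^ 3 := by
    have : d ^ 2 * d ≤ (144 / 100 * ξ ^ 2) * (12 / 10 * ξ) :=
      mul_le_mul dsq d2 hd0.le (by positivity)
    linarith
  have n3 : |w ^ 2 - 2 * m| ≤ 2 * ξ ^ 3 := by
    have : w ^ 2 - 2 * m = -(2 / 3) * d ^ 3 + d * d ^ 3 / 4 := by rw [hw, hmd]; ring
    have c0 : 0 < d ^ 3 := by positivity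
    have c1 := mul_le_mul_of_nonneg_right d1 c0.le
    have c2 := mul_pos hd0 c0
    rw [this, abs_le]
    constructor <;> linarith
  have n4 : |d * h ^ 2| ≤ 2 * ξ ^ 3 := by
    rw [abs_of_pos (by positivity)]
    have h2 : h ^ 2 ≤ 121 / 100 * ξ ^ 2 := by
      have := pow_le_pow_left₀ h0.le hu 2
      rw [mul_pow] at this
      linarith
    have := mul_le_mul d2 h2 (sq_nonneg h) (by positivity)
    linarith
  have ξK : ξ ^ 3 ≤ K * ξ ^ 3 := le_mul_of_one_le_left hξ3.le hK
  obtain ⟨n1a, n1b⟩ := abs_le.mp n1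
  obtain ⟨n2a, n2b⟩ := abs_le.mp n2
  obtain ⟨n3a, n3b⟩ := abs_le.mp n3
  obtain ⟨n4a, n4b⟩ := abs_le.mp n4
  -- The numerator is the sum of (p - 1)w², w² - 2m, 2m - ξ², ξ² - h² and d h², each at most a small
  -- multiple of K ξ³.
  have num : |p * w ^ 2 + (d - 1) * h ^ 2| ≤ 10 * (K * ξ ^ 3) := by
    rw [abs_le]
    constructor <;> linarith
  have : K * (58 / 100 * ξ ^ 3) ≤ K * (h * w ^ 2) := mul_le_mul_of_nonneg_left den (by linarith)
  linarith

/-- Quadratic and cubic Taylor bounds at the end point of an interval. -/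
theorem taylor_bounds {f f' f'' M : ℝ → ℝ} {b K : ℝ}
    (h1 : ∀ x ∈ Icc 0 b, HasDerivWithinAt f (f' x) (Icc 0 b) x)
    (h2 : ∀ x ∈ Icc 0 b, HasDerivWithinAt f' (f'' x) (Icc 0 b) x)
    (hM : ∀ x ∈ Icc 0 b, HasDerivWithinAt M (f x) (Icc 0 b) x)
    (hK : ∀ x ∈ Icc 0 b, |f'' x| ≤ K) (h0 : f 0 = 0) (h0' : f' 0 = 1) (hM0 : M 0 = 0)
    {x : ℝ} (hx : x ∈ Icc 0 b) :
    |f' x - 1| ≤ K * x ∧ |f x - x| ≤ K * x ^ 2 ∧ |M x - x ^ 2 / 2| ≤ K * x ^ 3 := by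
  have hK0 : 0 ≤ K := (abs_nonneg _).trans (hK x hx)
  have bound : ∀ {g g' : ℝ → ℝ} {C x : ℝ}, x ∈ Icc 0 b →
      (∀ z ∈ Icc 0 b, HasDerivWithinAt g (g' z) (Icc 0 b) z) →
      (∀ z ∈ Icc 0 x, |g' z| ≤ C) → |g x - g 0| ≤ C * x := by
    intro g g' C x hx hg hC
    have hsub : Icc 0 x ⊆ Icc 0 b := Icc_subset_Icc le_rfl hx.2
    have := (convex_Icc 0 x).norm_image_sub_le_of_norm_hasDerivWithin_le
      (fun z hz => (hg z (hsub hz)).mono hsub) (fun z hz => hC z hz)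
      (left_mem_Icc.mpr hx.1) (right_mem_Icc.mpr hx.1)
    rwa [Real.norm_eq_abs, Real.norm_eq_abs, sub_zero, abs_of_nonneg hx.1] at this
  have b1 : ∀ x ∈ Icc 0 b, |f' x - 1| ≤ K * x := by
    intro x hx
    have := bound hx h2 fun z hz => hK z ⟨hz.1, hz.2.trans hx.2⟩
    rwa [h0'] at this
  have b2 : ∀ x ∈ Icc 0 b, |f x - x| ≤ K * x ^ 2 := by
    intro x hx
    have := bound (g := fun z => f z - z) (C := K * x) hx
      (fun z hz => (h1 z hz).sub (hasDerivWithinAt_id z _)) fun z hz =>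
        (b1 z ⟨hz.1, hz.2.trans hx.2⟩).trans (mul_le_mul_of_nonneg_left hz.2 hK0)
    simp only [h0, sub_zero] at this
    linarith
  refine ⟨b1 x hx, b2 x hx, ?_⟩
  have := bound (g := fun z => M z - z ^ 2 / 2) (C := K * x ^ 2) hx
      (fun z hz => (hM z hz).sub (((hasDerivWithinAt_id z _).pow 2).div_const 2)) fun z hz => by
        have e : (2 : ℕ) * id z ^ (2 - 1) * 1 / 2 = z := by simp
        rw [e]
        exact (b2 z ⟨hz.1, hz.2.trans hx.2⟩).trans
          (mul_le_mul_of_nonneg_left (pow_le_pow_left₀ hz.1 hz.2 2) hK0)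
  simp only [hM0] at this
  norm_num at this
  linarith

/-- One-sided second space derivative of the height on the wetted interval. -/
def uXX (u : ℝ → ℝ → ℝ) (lm lp : ℝ → ℝ) (t x : ℝ) : ℝ :=
  iteratedDerivWithin 2 (u t) (Icc (lm t) (lp t)) x

namespace IsGlobalSmoothSolution

variable {u : ℝ → ℝ → ℝ} {lm lp : ℝ → ℝ} (S : IsGlobalSmoothSolution u lm lp)
  (hM : ∫ x in (lm 0)..(lp 0), u 0 x = 2 / 3)
include S

theorem hasDerivWithinAt_uX {t x : ℝ} (ht : 0 ≤ t) (hx : x ∈ Icc (lm t) (lp t)) :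
    HasDerivWithinAt (uX u lm lp t) (uXX u lm lp t x) (Icc (lm t) (lp t)) x := by
  rw [uXX, iteratedDerivWithin_succ]
  exact ((S.contDiffOn_u ht).differentiableOn_iteratedDerivWithin (m := 1) (by norm_num)
    (uniqueDiffOn_Icc (S.lt t ht)) x hx).hasDerivWithinAt

/-- The region is the continuous image of [0, T] × [0, 1] under affine interpolation between the
contact points. -/
theorem isCompact_region (T : ℝ) : IsCompact (closedRegion lm lp ∩ {p | p.1 ≤ T}) := by
  have hc : ContinuousOn (fun q : ℝ × ℝ => (q.1, lm q.1 + q.2 * (lp q.1 - lm q.1)))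
      (Icc 0 T ×ˢ Icc 0 1) := by
    have h1 : ContinuousOn (fun q : ℝ × ℝ => lm q.1) (Icc 0 T ×ˢ Icc 0 1) :=
      S.lm_continuous.comp continuousOn_fst fun q hq => hq.1.1
    have h2 : ContinuousOn (fun q : ℝ × ℝ => lp q.1) (Icc 0 T ×ˢ Icc 0 1) :=
      S.lp_continuous.comp continuousOn_fst fun q hq => hq.1.1
    exact continuousOn_fst.prodMk (h1.add (continuousOn_snd.mul (h2.sub h1)))
  have := (isCompact_Icc.prod isCompact_Icc).image_of_continuousOn hc
  convert this using 1
  ext ⟨t, x⟩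
  simp only [closedRegion, mem_inter_iff, mem_ofPred_eq, mem_image, mem_prod, Prod.exists,
    Prod.mk.injEq]
  constructor
  · rintro ⟨⟨ht, hx⟩, hT⟩
    have hlt := sub_pos.mpr (S.lt t ht)
    refine ⟨t, (x - lm t) / (lp t - lm t), ⟨⟨ht, hT⟩, div_nonneg (by linarith [hx.1]) hlt.le, ?_⟩,
      rfl, ?_⟩
    · rw [div_le_one hlt]; linarith [hx.2]
    · field_simp; ring
  · rintro ⟨s, θ, ⟨⟨hs, hT⟩, h0, h1⟩, rfl, rfl⟩
    have hlt := sub_pos.mpr (S.lt s hs)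
    refine ⟨⟨hs, ?_, ?_⟩, hT⟩ <;> nlinarith

/-- Taylor bounds for the height at the left contact point. -/
theorem bounds_left {t x K : ℝ} (ht : 0 ≤ t)
    (hK : ∀ z ∈ Icc (lm t) (lp t), |uXX u lm lp t z| ≤ K) (hx : x ∈ Icc (lm t) (lp t)) :
    |uX u lm lp t x - 1| ≤ K * (x - lm t) ∧ |u t x - (x - lm t)| ≤ K * (x - lm t) ^ 2 ∧
      |cumMass u lm lp t x - (x - lm t) ^ 2 / 2| ≤ K * (x - lm t) ^ 3 := by
  have hmap : MapsTo (fun ξ => lm t + ξ) (Icc 0 (lp t - lm t)) (Icc (lm t) (lp t)) :=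
    fun ξ hξ => ⟨by linarith [hξ.1], by linarith [hξ.2]⟩
  have shift : ∀ ξ, HasDerivWithinAt (fun ξ => lm t + ξ) 1 (Icc 0 (lp t - lm t)) ξ :=
    fun ξ => (hasDerivWithinAt_id ξ _).const_add _
  have := taylor_bounds (f := fun ξ => u t (lm t + ξ)) (f' := fun ξ => uX u lm lp t (lm t + ξ))
    (f'' := fun ξ => uXX u lm lp t (lm t + ξ)) (M := fun ξ => cumMass u lm lp t (lm t + ξ))
    (b := lp t - lm t) (K := K) (x := x - lm t)
    (fun ξ hξ =>
      ((S.hasDerivWithinAt_u ht (hmap hξ)).comp ξ (shift ξ) hmap).congr_deriv (by ring))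
    (fun ξ hξ =>
      ((S.hasDerivWithinAt_uX ht (hmap hξ)).comp ξ (shift ξ) hmap).congr_deriv (by ring))
    (fun ξ hξ => by
      have h1 := (S.hasDerivAt_cumMass t (lm t + ξ)).hasDerivWithinAt (s := Icc (lm t) (lp t))
      rw [filmExt_eq ht (hmap hξ)] at h1
      exact (h1.comp ξ (shift ξ) hmap).congr_deriv (by ring))
    (fun ξ hξ => hK _ (hmap hξ))
    (by simp [S.left_zero t ht]) (by simp [S.uX_left ht]) (by simp [cumMass_left ht])
    ⟨by linarith [hx.1], by linarith [hx.2]⟩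
  simpa only [add_sub_cancel] using this

include hM

/-- Taylor bounds for the height at the right contact point. -/
theorem bounds_right {t x K : ℝ} (ht : 0 ≤ t)
    (hK : ∀ z ∈ Icc (lm t) (lp t), |uXX u lm lp t z| ≤ K) (hx : x ∈ Icc (lm t) (lp t)) :
    |-uX u lm lp t x - 1| ≤ K * (lp t - x) ∧ |u t x - (lp t - x)| ≤ K * (lp t - x) ^ 2 ∧
      |2 / 3 - cumMass u lm lp t x - (lp t - x) ^ 2 / 2| ≤ K * (lp t - x) ^ 3 := by
  have hmap : MapsTo (fun ξ => lp t - ξ) (Icc 0 (lp t - lm t)) (Icc (lm t) (lp t)) :=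
    fun ξ hξ => ⟨by linarith [hξ.2], by linarith [hξ.1]⟩
  have shift : ∀ ξ, HasDerivWithinAt (fun ξ => lp t - ξ) (-1) (Icc 0 (lp t - lm t)) ξ :=
    fun ξ => (hasDerivWithinAt_id ξ _).const_sub _
  have := taylor_bounds (f := fun ξ => u t (lp t - ξ)) (f' := fun ξ => -uX u lm lp t (lp t - ξ))
    (f'' := fun ξ => uXX u lm lp t (lp t - ξ))
    (M := fun ξ => 2 / 3 - cumMass u lm lp t (lp t - ξ))
    (b := lp t - lm t) (K := K) (x := lp t - x)
    (fun ξ hξ =>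
      ((S.hasDerivWithinAt_u ht (hmap hξ)).comp ξ (shift ξ) hmap).congr_deriv (by ring))
    (fun ξ hξ =>
      ((S.hasDerivWithinAt_uX ht (hmap hξ)).comp ξ (shift ξ) hmap).neg.congr_deriv (by ring))
    (fun ξ hξ => by
      have h1 := (S.hasDerivAt_cumMass t (lp t - ξ)).hasDerivWithinAt (s := Icc (lm t) (lp t))
      rw [filmExt_eq ht (hmap hξ)] at h1
      exact ((h1.comp ξ (shift ξ) hmap).const_sub (2 / 3)).congr_deriv (by ring))
    (fun ξ hξ => hK _ (hmap hξ))
    (by simp [S.right_zero t ht]) (by simp [S.uX_right ht])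
    (by simp [S.mass_eq hM ht])
    ⟨by linarith [hx.2], by linarith [hx.1]⟩
  simpa only [sub_sub_cancel] using this

/-- Derivative of the ratio of the height and the stationary profile, for all `t ≥ 0`. -/
theorem hasDerivAt_height_div {t y : ℝ} (ht : 0 ≤ t) (hy : y ∈ Ioo (-1 : ℝ) 1) :
    HasDerivAt (fun z => lagrangianHeight u lm lp t z / steadyState z)
      (uX u lm lp t (lagrangianMap u lm lp t y) / lagrangianHeight u lm lp t y +
        y * lagrangianHeight u lm lp t y / ((1 - y ^ 2) / 2) ^ 2) y := by
  have hm := S.lagrangianMap_mem_Ioo hM ht hy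
  have hpos := S.lagrangianHeight_pos hM ht hy
  have hw : 0 < 1 - y ^ 2 := by nlinarith [hy.1, hy.2]
  have h1 := ((S.hasDerivWithinAt_u ht (Ioo_subset_Icc_self hm)).hasDerivAt
    (Icc_mem_nhds hm.1 hm.2)).comp y (S.hasDerivAt_lagrangianMap hM ht hy)
  have hs : HasDerivAt steadyState (-y) y := by
    have h2 : HasDerivAt (fun y : ℝ => (1 - y ^ 2) / 2) (-y) y :=
      ((((hasDerivAt_id y).pow 2).const_sub 1).div_const 2).congr_deriv (by simp; ring)
    refine h2.congr_of_eventuallyEq ?_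
    filter_upwards [isOpen_Ioo.mem_nhds hy] with z hz
    rw [steadyState, max_eq_left (by nlinarith [hz.1, hz.2])]
    ring
  have hsy : steadyState y = (1 - y ^ 2) / 2 := by
    rw [steadyState, max_eq_left hw.le]; ring
  have h3 : HasDerivAt (lagrangianHeight u lm lp t) _ y := h1
  refine (h3.div hs (by rw [hsy]; positivity)).congr_deriv ?_
  rw [hsy]
  field_simp
  ring

/-- Near the initial time, `∂_y (ũ / u^∞)` is bounded. -/
theorem exists_bound_deriv :
    ∃ B : ℝ, ∀ t ∈ Icc (0 : ℝ) 1, ∀ y ∈ Ioo (-1 : ℝ) 1,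
      |uX u lm lp t (lagrangianMap u lm lp t y) / lagrangianHeight u lm lp t y +
        y * lagrangianHeight u lm lp t y / ((1 - y ^ 2) / 2) ^ 2| ≤ B := by
  have hR := S.isCompact_region 1
  have hsub : closedRegion lm lp ∩ {p | p.1 ≤ 1} ⊆ closedRegion lm lp := inter_subset_left
  obtain ⟨K0, hK0⟩ := hR.exists_bound_of_continuousOn ((S.initial.2 0 (by norm_num)).mono hsub)
  obtain ⟨K1, hK1⟩ := hR.exists_bound_of_continuousOn ((S.initial.2 1 (by norm_num)).mono hsub)
  obtain ⟨K2, hK2⟩ := hR.exists_bound_of_continuousOn ((S.initial.2 2 (by norm_num)).mono hsub)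
  set K := max K2 1 with hK
  have hKpos : 1 ≤ K := le_max_right _ _
  -- This is the distance up to which the contact expansion is valid, K ξ ≤ 1/10. Points farther
  -- than ξ₀ from both ends form a compact set on which u is bounded below.
  set ξ₀ : ℝ := 1 / (10 * K) with hξ₀
  have hξ₀pos : 0 < ξ₀ := by positivity
  set R := closedRegion lm lp ∩ {p | p.1 ≤ 1} ∩
    {p | lm (max p.1 0) + ξ₀ ≤ p.2 ∧ p.2 ≤ lp (max p.1 0) - ξ₀} with hRdef
  have hRc : IsCompact R := by
    refine hR.inter_right (IsClosed.inter (isClosed_le ?_ continuous_snd)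
      (isClosed_le continuous_snd ?_))
    · exact (S.continuous_lm.comp continuous_fst).add continuous_const
    · exact (S.continuous_lp.comp continuous_fst).sub continuous_const
  have hRioo : ∀ p ∈ R, 0 ≤ p.1 ∧ p.2 ∈ Ioo (lm p.1) (lp p.1) := by
    rintro p ⟨⟨⟨h0, _⟩, _⟩, h1, h2⟩
    rw [max_eq_left h0] at h1 h2
    exact ⟨h0, by linarith, by linarith⟩
  have hMc : Continuous fun p : ℝ × ℝ => cumMass u lm lp p.1 p.2 := S.continuous_cumMass
  have hmpos : ∀ p ∈ R, 0 < cumMass u lm lp p.1 p.2 * (2 / 3 - cumMass u lm lp p.1 p.2) := by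
    intro p hp
    obtain ⟨h0, h1⟩ := hRioo p hp
    have hlt := (S.lt p.1 h0).le
    have a := S.strictMonoOn_cumMass h0 (left_mem_Icc.mpr hlt) (Ioo_subset_Icc_self h1) h1.1
    have b := S.strictMonoOn_cumMass h0 (Ioo_subset_Icc_self h1) (right_mem_Icc.mpr hlt) h1.2
    rw [cumMass_left h0] at a
    rw [S.mass_eq hM h0] at b
    exact mul_pos a (by linarith)
  obtain ⟨B1, hB1⟩ := hRc.exists_bound_of_continuousOn (f := fun p => (u p.1 p.2)⁻¹)
    ((S.u_continuousOn.mono (inter_subset_left.trans hsub)).inv₀ fun p hp =>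
      (S.pos p.1 (hRioo p hp).1 p.2 (hRioo p hp).2).ne')
  obtain ⟨B2, hB2⟩ := hRc.exists_bound_of_continuousOn
    (f := fun p => (cumMass u lm lp p.1 p.2 * (2 / 3 - cumMass u lm lp p.1 p.2))⁻¹)
    ((hMc.mul (continuous_const.sub hMc)).continuousOn.inv₀ fun p hp => (hmpos p hp).ne')
  refine ⟨max (20 * K) (K1 * B1 + K0 * (2 * B2) ^ 2), fun t ht y hy => ?_⟩
  have hZ := S.lagrangianMap_mem_Ioo hM ht.1 hy
  have hZI := Ioo_subset_Icc_self hZ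
  have hmass := (S.lagrangianMap_spec hM ht.1 (Ioo_subset_Icc_self hy)).2
  have hpos := S.lagrangianHeight_pos hM ht.1 hy
  have hh : lagrangianHeight u lm lp t y = u t (lagrangianMap u lm lp t y) := rfl
  set x := lagrangianMap u lm lp t y with hx
  rw [hh] at hpos ⊢
  have hKt : ∀ z ∈ Icc (lm t) (lp t), |uXX u lm lp t z| ≤ K := fun z hz =>
    (hK2 (t, z) ⟨⟨ht.1, hz⟩, ht.2⟩).trans (le_max_left _ _)
  have hKξ : ∀ ξ, ξ < ξ₀ → K * ξ ≤ 1 / 10 := by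
    intro ξ hξ
    have h1 : K * ξ ≤ K * ξ₀ := mul_le_mul_of_nonneg_left hξ.le (by linarith)
    have h2 : K * ξ₀ = 1 / 10 := by rw [hξ₀]; field_simp
    linarith
  rcases lt_or_ge (x - lm t) ξ₀ with hl | hl
  · obtain ⟨b1, b2, b3⟩ := S.bounds_left ht.1 hKt hZI
    have := contact_estimate (ξ := x - lm t) (d := 1 + y) (by linarith [hZ.1]) hKpos
      (hKξ _ hl) b1 b2 b3 (by rw [hmass, steadyMass]; ring) (by linarith [hy.1])
      (by linarith [hy.2])
    refine le_trans (le_of_eq ?_) (this.trans (le_max_left _ _))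
    congr 2; ring
  rcases lt_or_ge (lp t - x) ξ₀ with hr | hr
  · obtain ⟨b1, b2, b3⟩ := S.bounds_right hM ht.1 hKt hZI
    have := contact_estimate (ξ := lp t - x) (d := 1 - y) (by linarith [hZ.2]) hKpos
      (hKξ _ hr) b1 b2 b3 (by rw [hmass, steadyMass]; ring) (by linarith [hy.2])
      (by linarith [hy.1])
    refine le_trans (le_of_eq ?_) (this.trans (le_max_left _ _))
    rw [← abs_neg]
    congr 1
    have e : (1 - y) * (2 - (1 - y)) / 2 = (1 - y ^ 2) / 2 := by ring
    rw [e]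
    ring
  · have hpR : (t, x) ∈ R := by
      refine ⟨⟨⟨ht.1, hZI⟩, ht.2⟩, ?_, ?_⟩
      · simp only [max_eq_left ht.1]; linarith
      · simp only [max_eq_left ht.1]; linarith
    have c0 : |u t x| ≤ K0 := by simpa using hK0 (t, x) hpR.1
    have c1 : |uX u lm lp t x| ≤ K1 := hK1 (t, x) hpR.1
    have c2 : |(u t x)⁻¹| ≤ B1 := hB1 (t, x) hpR
    have c3 := hB2 (t, x) hpR
    have c4 := hmpos (t, x) hpR
    simp only [hmass] at c3 c4
    have hw : 0 < (1 - y ^ 2) / 2 := by nlinarith [hy.1, hy.2]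
    -- Compactness is known in x, while the weight depends on y. The two are linked by mass: the
    -- stationary masses on either side of y are at most 1 + y and 1 - y, so a lower bound on their
    -- product bounds the weight below.
    have c5 : ((1 - y ^ 2) / 2)⁻¹ ≤ 2 * B2 := by
      rw [Real.norm_eq_abs, abs_of_pos (inv_pos.mpr c4)] at c3
      have d1 : 0 < 1 + y := by linarith [hy.1]
      have d2 : 0 < 1 - y := by linarith [hy.2]
      have m1 : steadyMass y ≤ 1 + y := by
        unfold steadyMass; nlinarith [mul_pos d1 d2, mul_pos d1 (mul_pos d2 d2), sq_nonneg y]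
      have m2 : 2 / 3 - steadyMass y ≤ 1 - y := by
        unfold steadyMass; nlinarith [mul_pos d1 d2, mul_pos d2 (mul_pos d1 d1), sq_nonneg y]
      have m3 := steadyMass_mem_Ioo hy
      have m4 : steadyMass y * (2 / 3 - steadyMass y) ≤ (1 + y) * (1 - y) :=
        mul_le_mul m1 m2 (by linarith [m3.2]) d1.le
      have m5 := inv_anti₀ c4 m4
      have e : ((1 - y ^ 2) / 2)⁻¹ = 2 * ((1 + y) * (1 - y))⁻¹ := by
        have : (1 + y) * (1 - y) = 1 - y ^ 2 := by ring
        rw [this]; field_simp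
      rw [e]; linarith
    refine le_trans ?_ (le_max_right _ _)
    refine (abs_add_le _ _).trans (add_le_add ?_ ?_)
    · rw [div_eq_mul_inv, abs_mul]
      exact mul_le_mul c1 c2 (abs_nonneg _) ((abs_nonneg _).trans c1)
    · have e : y * u t x / ((1 - y ^ 2) / 2) ^ 2 = y * (u t x * (((1 - y ^ 2) / 2)⁻¹) ^ 2) := by
        field_simp
      have e2 : |(((1 - y ^ 2) / 2)⁻¹) ^ 2| = (((1 - y ^ 2) / 2)⁻¹) ^ 2 :=
        abs_of_nonneg (sq_nonneg _)
      rw [e, abs_mul, abs_mul, e2]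
      have hy1 : |y| ≤ 1 := abs_le.mpr ⟨hy.1.le, hy.2.le⟩
      have f1 : (((1 - y ^ 2) / 2)⁻¹) ^ 2 ≤ (2 * B2) ^ 2 :=
        pow_le_pow_left₀ (inv_pos.mpr hw).le c5 2
      have f2 := mul_le_mul c0 f1 (sq_nonneg _) ((abs_nonneg _).trans c0)
      exact (mul_le_of_le_one_left (by positivity) hy1).trans f2

end IsGlobalSmoothSolution

/-! ### Passage to the initial time and the final estimates -/

namespace IsGlobalSmoothSolution

variable {u : ℝ → ℝ → ℝ} {lm lp : ℝ → ℝ} (S : IsGlobalSmoothSolution u lm lp)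
  (hM : ∫ x in (lm 0)..(lp 0), u 0 x = 2 / 3)
include S

theorem uX_continuousOn :
    ContinuousOn (fun p : ℝ × ℝ => uX u lm lp p.1 p.2) (closedRegion lm lp) :=
  S.initial.2 1 (by norm_num)

include hM

/-- The energy is continuous at the initial time. -/
theorem tendsto_energy :
    Tendsto (energy u lm lp) (𝓝[>] 0) (𝓝 (energy u lm lp 0)) := by
  obtain ⟨B, hB⟩ := S.exists_bound_deriv hM
  refine ENNReal.Tendsto.const_mul ?_ (Or.inr (by simp))
  -- At fixed interior y the derivative involves only u and u_x, which are continuous down to t = 0;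
  -- the uniform bound near t = 0 dominates.
  refine tendsto_lintegral_filter_of_dominated_convergence (fun _ => ENNReal.ofReal B ^ 2)
    ?_ ?_ ?_ ?_
  · exact Eventually.of_forall fun t => ((measurable_deriv _).enorm.pow_const 2)
  · filter_upwards [Ioo_mem_nhdsGT (zero_lt_one (α := ℝ))] with t ht
    refine (ae_restrict_iff' measurableSet_Ioo).mpr (Eventually.of_forall fun y hy => ?_)
    rw [(S.hasDerivAt_height_div hM ht.1.le hy).deriv]
    gcongr
    rw [Real.enorm_eq_ofReal_abs]
    exact ENNReal.ofReal_le_ofReal (hB t ⟨ht.1.le, ht.2.le⟩ y hy)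
  · rw [lintegral_const]
    exact ENNReal.mul_ne_top (by simp) (by simp)
  · refine (ae_restrict_iff' measurableSet_Ioo).mpr (Eventually.of_forall fun y hy => ?_)
    have hyI := Ioo_subset_Icc_self hy
    have hZ : ContinuousOn (fun t => lagrangianMap u lm lp t y) (Ici 0) :=
      (S.continuousOn_lagrangianMap hM).comp (f := fun t : ℝ => (t, y)) (by fun_prop)
        fun t ht => ⟨ht, hyI⟩
    have hZmaps : MapsTo (fun t => (t, lagrangianMap u lm lp t y)) (Ici 0) (closedRegion lm lp) :=
      fun t ht => ⟨ht, (S.lagrangianMap_spec hM ht hyI).1⟩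
    have hpair : ContinuousOn (fun t => (t, lagrangianMap u lm lp t y)) (Ici 0) :=
      continuousOn_id.prodMk hZ
    have hux := S.uX_continuousOn
    have h1 : ContinuousOn (fun t => uX u lm lp t (lagrangianMap u lm lp t y)) (Ici 0) :=
      hux.comp (f := fun t => (t, lagrangianMap u lm lp t y)) hpair hZmaps
    have h2 : ContinuousOn (fun t => lagrangianHeight u lm lp t y) (Ici 0) :=
      S.u_continuousOn.comp (f := fun t => (t, lagrangianMap u lm lp t y)) hpair hZmaps
    have h3 : ContinuousOn (fun t =>
        uX u lm lp t (lagrangianMap u lm lp t y) / lagrangianHeight u lm lp t y +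
        y * lagrangianHeight u lm lp t y / ((1 - y ^ 2) / 2) ^ 2) (Ici 0) :=
      (h1.div h2 fun t ht => (S.lagrangianHeight_pos hM ht hy).ne').add
        ((continuousOn_const.mul h2).div_const _)
    have h4 := ((h3 0 self_mem_Ici).mono Ioi_subset_Ici_self).tendsto
    rw [← (S.hasDerivAt_height_div hM le_rfl hy).deriv] at h4
    have h5 := (ENNReal.continuous_pow 2).continuousAt.tendsto.comp
      ((continuous_enorm.tendsto _).comp h4)
    refine h5.congr' ?_
    filter_upwards [self_mem_nhdsWithin] with t ht
    simp only [Function.comp]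
    rw [(S.hasDerivAt_height_div hM (le_of_lt ht) hy).deriv]

theorem energy_eq {t : ℝ} (ht : 0 < t) :
    energy u lm lp t =
      ENNReal.ofReal (1 / 2 * ∫ y in (-1)..1, sY (ratio u lm lp) (t, y) ^ 2) := by
  have s0 := S.contDiffOn_ratio hM
  have hc : ContinuousOn (fun y => sY (ratio u lm lp) (t, y) ^ 2) (Icc (-1) 1) :=
    (continuousOn_strip_slice (contDiffOn_sY s0) ht).pow 2
  have hint : IntegrableOn (fun y => sY (ratio u lm lp) (t, y) ^ 2) (Ioo (-1) 1) :=
    (hc.integrableOn_compact isCompact_Icc).mono_set Ioo_subset_Icc_self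
  rw [ENNReal.ofReal_mul (by norm_num), intervalIntegral.integral_of_le (by norm_num),
    integral_Ioc_eq_integral_Ioo, ofReal_integral_eq_lintegral_ofReal hint
      (Eventually.of_forall fun _ => sq_nonneg _), energy]
  congr 1
  · rw [ENNReal.ofReal_div_of_pos (by norm_num)]; simp
  · refine setLIntegral_congr_fun measurableSet_Ioo fun y hy => ?_
    have hd : HasDerivAt (fun z => lagrangianHeight u lm lp t z / steadyState z)
        (sY (ratio u lm lp) (t, y)) y := by
      refine (hasDerivAt_sY s0 ht hy).congr_of_eventuallyEq ?_
      filter_upwards [isOpen_Ioo.mem_nhds hy] with z hz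
      have hw : 0 ≤ 1 - z ^ 2 := by nlinarith [hz.1, hz.2]
      rw [ratio, S.sY_lagr hM ht hz, inv_div, steadyState, max_eq_left hw]
      congr 1; ring
    rw [hd.deriv, Real.enorm_eq_ofReal_abs, ← ENNReal.ofReal_pow (abs_nonneg _), sq_abs]

/-- Smallness at t = 0 carries over to small s > 0 by convergence of the energy. Decay holds from
each such s, and letting s tend to 0 restores the initial energy on the right. -/
theorem energy_decay (h0 : energy u lm lp 0 < ENNReal.ofReal (1 / 2 * (1 / 1000) ^ 2)) {t : ℝ}
    (ht : 0 ≤ t) :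
    energy u lm lp t ≤ energy u lm lp 0 * ENNReal.ofReal (Real.exp (-(1 / 16) * t)) := by
  rcases ht.eq_or_lt with h | h
  · rw [← h]; simp
  have hlim : Tendsto (fun s => energy u lm lp s * ENNReal.ofReal (Real.exp (-(1 / 16) * (t - s))))
      (𝓝[>] 0) (𝓝 (energy u lm lp 0 * ENNReal.ofReal (Real.exp (-(1 / 16) * t)))) := by
    refine ENNReal.Tendsto.mul (S.tendsto_energy hM) (Or.inr ENNReal.ofReal_ne_top) ?_
      (Or.inr h0.ne_top)
    have hc : Continuous fun s : ℝ => ENNReal.ofReal (Real.exp (-(1 / 16) * (t - s))) :=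
      ENNReal.continuous_ofReal.comp (by fun_prop)
    have := (hc.tendsto 0).mono_left (nhdsWithin_le_nhds (s := Ioi 0))
    simpa only [sub_zero] using this
  refine ge_of_tendsto hlim ?_
  filter_upwards [(S.tendsto_energy hM).eventually (gt_mem_nhds h0), Ioo_mem_nhdsGT h]
    with s hs hst
  have hsmall : ∫ y in (-1)..1, sY (ratio u lm lp) (s, y) ^ 2 < (1 / 1000) ^ 2 := by
    rw [S.energy_eq hM hst.1, ENNReal.ofReal_lt_ofReal_iff (by norm_num)] at hs
    linarith
  have key := S.dirichlet_decay hM hst.1 hst.2.le hsmall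
  rw [S.energy_eq hM h, S.energy_eq hM hst.1, ← ENNReal.ofReal_mul']
  · apply ENNReal.ofReal_le_ofReal
    linarith
  · positivity

/-- The supremum bound for `∂_y Z - 1` in terms of the energy. -/
theorem abs_deriv_sub_one_le {t y : ℝ} (ht : 0 < t) (hy : y ∈ Ioo (-1 : ℝ) 1) {ε : ℝ}
    (hε0 : 0 ≤ ε) (hε : ε ≤ 1 / 1000)
    (hQ : ∫ y in (-1)..1, sY (ratio u lm lp) (t, y) ^ 2 ≤ ε ^ 2) :
    |sY (lagr u lm lp) (t, y) - 1| ≤ 4 * ε := by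
  have s0 := S.contDiffOn_ratio hM
  have hyI := Ioo_subset_Icc_self hy
  have h1 := sq_sub_le (continuousOn_strip_slice s0 ht)
    (fun z hz => hasDerivAt_sY s0 ht hz) (continuousOn_strip_slice (contDiffOn_sY s0) ht)
    (left_mem_Icc.mpr (by norm_num)) hyI
  rw [S.ratio_left hM ht, abs_of_pos (by linarith [hy.1])] at h1
  -- Integrating from y = -1 over a length of at most 2 gives |F - 1| ≤ 2ε. Passing to Z_y = 1/F
  -- with F ≥ 1/2 costs another factor two.
  have h2 : (ratio u lm lp (t, y) - 1) ^ 2 ≤ (2 * ε) ^ 2 := by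
    have h3 : (y - -1) * ∫ s in (-1)..1, sY (ratio u lm lp) (t, s) ^ 2 ≤ 2 * ε ^ 2 :=
      mul_le_mul (by linarith [hy.2]) hQ
        (intervalIntegral.integral_nonneg (by norm_num) fun _ _ => sq_nonneg _) (by norm_num)
    nlinarith [sq_nonneg ε]
  have h4 := abs_le_of_sq_le_sq h2 (by linarith)
  obtain ⟨h5, h6⟩ := abs_le.mp h4
  have hr : 1 / 2 ≤ ratio u lm lp (t, y) := by linarith
  have hr0 : 0 < ratio u lm lp (t, y) := by linarith
  have e : sY (lagr u lm lp) (t, y) - 1 = -(ratio u lm lp (t, y) - 1) / ratio u lm lp (t, y) := by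
    have : sY (lagr u lm lp) (t, y) = (ratio u lm lp (t, y))⁻¹ := by rw [ratio, inv_inv]
    rw [this]; field_simp; ring
  rw [e, abs_div, abs_neg, abs_of_pos hr0, div_le_iff₀ hr0]
  nlinarith

theorem eLpNorm_deriv_le (h0 : energy u lm lp 0 < ENNReal.ofReal (1 / 2 * (1 / 1000) ^ 2)) {t : ℝ}
    (ht : 0 < t) :
    eLpNorm (deriv fun y => lagrangianMap u lm lp t y - steadyLagrangianMap y) ∞
      (volume.restrict (Ioo (-1 : ℝ) 1)) ≤ ENNReal.ofReal (Real.exp (-(1 / 16) / 2 * t)) := by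
  have hE := S.energy_decay hM h0 ht.le
  have hQ : ∫ y in (-1)..1, sY (ratio u lm lp) (t, y) ^ 2 ≤
      (1 / 1000 * Real.exp (-(1 / 16) / 2 * t)) ^ 2 := by
    have h1 := hE.trans (mul_le_mul_left h0.le _)
    rw [S.energy_eq hM ht, ← ENNReal.ofReal_mul (by norm_num),
      ENNReal.ofReal_le_ofReal_iff (by positivity)] at h1
    have h2 : Real.exp (-(1 / 16) * t) = Real.exp (-(1 / 16) / 2 * t) ^ 2 := by
      rw [← Real.exp_nat_mul]; congr 1; push_cast; ring
    rw [h2] at h1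
    rw [mul_pow]
    linarith
  have hexp : Real.exp (-(1 / 16) / 2 * t) ≤ 1 := by
    rw [Real.exp_le_one_iff]; linarith
  have hexp0 := Real.exp_pos (-(1 / 16) / 2 * t)
  rw [eLpNorm_exponent_top]
  refine eLpNormEssSup_le_of_ae_bound ?_
  refine (ae_restrict_iff' measurableSet_Ioo).mpr (Eventually.of_forall fun y hy => ?_)
  have hd : HasDerivAt (fun y => lagrangianMap u lm lp t y - steadyLagrangianMap y)
      (sY (lagr u lm lp) (t, y) - 1) y :=
    (hasDerivAt_sY (S.contDiffOn_lagr hM) ht hy).sub (hasDerivAt_id y)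
  rw [hd.deriv, Real.norm_eq_abs]
  have := S.abs_deriv_sub_one_le hM ht hy (by positivity) (by linarith) hQ
  linarith

end IsGlobalSmoothSolution

end ThinFilm

end

theorem corollary1p5 :
    ∃ c₀ γ C T : ℝ, 0 < c₀ ∧ 0 < γ ∧ 0 < C ∧ 0 ≤ T ∧
      ∀ (u : ℝ → ℝ → ℝ) (lm lp : ℝ → ℝ),
        ThinFilm.IsGlobalSmoothSolution u lm lp →
        (∫ x in (lm 0)..(lp 0), u 0 x) = 2 / 3 →
        (∫ x in (lm 0)..(lp 0), x * u 0 x) = 0 →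
        ThinFilm.energy u lm lp 0 < ENNReal.ofReal c₀ →
          (∀ t : ℝ, 0 ≤ t →
            ThinFilm.energy u lm lp t
              ≤ ThinFilm.energy u lm lp 0 * ENNReal.ofReal (Real.exp (-γ * t))) ∧
          ∀ t : ℝ, T ≤ t →
            DifferentiableOn ℝ (ThinFilm.lagrangianMap u lm lp t) (Ioo (-1) 1) ∧
            eLpNorm
                (deriv fun y =>
                  ThinFilm.lagrangianMap u lm lp t y - ThinFilm.steadyLagrangianMap y)
                ∞ (volume.restrict (Ioo (-1 : ℝ) 1))
              ≤ ENNReal.ofReal (C * Real.exp (-γ / 2 * t)) := by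
  -- The value c₀ is half the threshold 10⁻⁶ for the Dirichlet integral, and γ = 1/16 is the
  -- comparison rate. C = 1 is ample since 4/1000 ≤ 1. Any T > 0 would do: the sup bound uses the
  -- smoothness of F up to the boundary at positive times.
  refine ⟨1 / 2 * (1 / 1000) ^ 2, 1 / 16, 1, 1, by norm_num, by norm_num, by norm_num, by norm_num,
    fun u lm lp S hM _ h0 =>
      ⟨fun t ht => S.energy_decay hM h0 ht, fun t ht => ⟨fun y hy => ?_, ?_⟩⟩⟩
  · exact (S.hasDerivAt_lagrangianMap hM (by linarith) hy).differentiableAt.differentiableWithinAt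
  · rw [one_mul]
    exact S.eLpNorm_deriv_le hM h0 (by linarith)
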